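/- Let $\Bbbk$ be a field of characteristic $0$. A \emph{directed simple graph} is a finite connected directed graph with at least one vertex, without oriented cycles and with at most one edge between two vertices; edges are thought of as going from top to bottom, and the $|\mathrm g|$ vertices of $\mathrm g$ are labelled bijectively by $1,\dots,|\mathrm g|$. The operad $\mathrm{Lie}\textrm{-}\mathrm{gra}$ is spanned by these graphs; $\mathrm g_1\circ_i\mathrm g_2$ is the sum of all graphs obtained by inserting $\mathrm g_2$ at the vertex $i$ of $\mathrm g_1$ and replacing each edge between a vertex $j$ and $i$ by edges of the same direction between $j$ and at least one vertex of $\mathrm g_2$ (with the usual shift of labels), and its unit is the one-vertex graph. A \emph{complete Lie-graph algebra} is a $\mathbb Z$-graded $\Bbbk$-vector space $\mathfrak g$ with a descending filtration $\mathfrak g_n=\mathrm F_0\mathfrak g_n\supset \mathrm F_1\mathfrak g_n\supset\cdots$ of each component by subspaces such that $\mathfrak g_n\cong\varprojlim_k\mathfrak g_n/\mathrm F_k\mathfrak g_n$, with an algebra structure over $\mathrm{Lie}\textrm{-}\mathrm{gra}$ (with Koszul signs) whose operations $\mathrm g\colon\mathfrak g^{\otimes|\mathrm g|}\to\mathfrak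 g$ have degree $0$ and satisfy $\mathrm g(\mathrm F_{i_1}\mathfrak g,\dots,\mathrm F_{i_k}\mathfrak g)\subset\mathrm F_{i_1+\cdots+i_k}\mathfrak g$. Morphisms are the linear maps of degree $0$ that preserve the filtrations and commute with all operations. A \emph{complete group} is a group $G$ with a descending filtration $G=\mathrm F_1G\supset\mathrm F_2G\supset\cdots$ by normal subgroups such that $G\to\varprojlim_k G/\mathrm F_kG$ is an isomorphism; morphisms are the group morphisms preserving the filtrations. A \emph{$k$-leveled directed simple graph} is a directed simple graph with unlabelled vertices (that is, up to isomorphism) whose vertices are placed on $k$ levels, possibly empty, so that every edge goes from a level to a strictly lower level; $\mathrm{Aut}(\mathrm g)$ is the group of permutations of its vertices preserving adjacency and levels. For elements $x_1,\dots,x_k$ of degree $0$, $\mathrm g(x_1,\dots,x_k)$ denotes the action of $\mathrm g$ with all vertices of the $l$-th level from the bottom labelled by $x_l$. \textbf{Theorem.} For every complete Lie-graph algebra $\mathfrak g$, let $\mathbb 1+\mathrm F_1\mathfrak g_0=\{\mathbb 1+x\mid x\in\mathrm F_1\mathfrak g_0\}$, where $\mathbb 1$ is a formal symbol. For $x,y\in\mathrm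 F_1\mathfrak g_0$, the sum in $$(\mathbb 1+x)\circledcirc(\mathbb 1+y):=\mathbb 1+\sum_{\mathrm g\ 2\text{-leveled}}\frac1{|\mathrm{Aut}(\mathrm g)|}\,\mathrm g(x,y)$$ converges in $\mathrm F_1\mathfrak g_0$, and $$\big(\mathbb 1+\mathrm F_1\mathfrak g_0,\ \{\mathbb 1+\mathrm F_k\mathfrak g_0\}_{k\ge1},\ \circledcirc,\ \mathbb 1\big)$$ is a complete group. Moreover, for $x,y,z\in\mathrm F_1\mathfrak g_0$, $$\big((\mathbb 1+x)\circledcirc(\mathbb 1+y)\big)\circledcirc(\mathbb 1+z)=(\mathbb 1+x)\circledcirc\big((\mathbb 1+y)\circledcirc(\mathbb 1+z)\big)=\mathbb 1+\sum_{\mathrm g\ 3\text{-leveled}}\frac1{|\mathrm{Aut}(\mathrm g)|}\,\mathrm g(x,y,z).$$ Together with $f\mapsto\big(\mathbb 1+x\mapsto\mathbb 1+f(x)\big)$ on morphisms, this assignment is a functor from complete Lie-graph algebras to complete groups. -/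

import Mathlib

open CategoryTheory Filter

universe u v

/-! ### Directed simple graphs -/

/-- A directed simple graph with vertex set `V`: `adj a b` means that there is an edge going down
from `a` to `b`. The graph is connected (in particular it has at least one vertex) and directed by
a global flow, i.e. it has no oriented cycle; hence no loop, and at most one edge between two
vertices. -/
@[ext]
structure DSGraph (V : Type) where
  adj : V → V → Prop
  acyclic : ∀ a, ¬ Relation.TransGen adj a a
  connected : (SimpleGraph.fromRel adj).Connected

namespace DSGraph

instance {V : Type} [Finite V] : Finite (DSGraph V) :=
  Finite.of_injective (fun g : DSGraph V => g.adj) fun _ _ h => DSGraph.ext h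

/-- The action of bijections on the labels of the vertices: the vertex `a` of `g` becomes the
vertex `e a` of `g.relabel e`. -/
def relabel {V W : Type} (e : V ≃ W) (g : DSGraph V) : DSGraph W where
  adj a b := g.adj (e.symm a) (e.symm b)
  acyclic a h := g.acyclic (e.symm a) (Relation.TransGen.lift e.symm (fun _ _ hab => hab) _ _ h)
  connected := by
    have iso : SimpleGraph.fromRel g.adj ≃g
        SimpleGraph.fromRel (fun a b => g.adj (e.symm a) (e.symm b)) :=
      { toEquiv := e
        map_rel_iff' := by intro a b; simp [SimpleGraph.fromRel_adj] }
    exact iso.connected_iff.mp g.connected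

/-- The label in `g₁ ∘ᵢ g₂` of the vertex `b` of `g₂`: labels are shifted by `i`
(labels start at `0`). -/
def inner {m n : ℕ} (i : Fin (m + 1)) (b : Fin n) : Fin (m + n) :=
  ⟨i + b, by omega⟩

/-- The label in `g₁ ∘ᵢ g₂` of a vertex `j ≠ i` of `g₁`: unchanged before `i`, shifted by
`|g₂| - 1` after `i`. -/
def outer {m n : ℕ} (i : Fin (m + 1)) (j : Fin (m + 1)) (hj : j ≠ i) : Fin (m + n) :=
  if h : j < i then ⟨j, by omega⟩ else ⟨j + n - 1, by omega⟩

/-- `h` is one of the graphs obtained by inserting `g₂` at the vertex `i` of `g₁` and by replacing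
every edge between a vertex `j` and `i` by edges, of the same direction, between `j` and at least
one vertex of `g₂`. -/
structure IsInsertion {m n : ℕ} (g₁ : DSGraph (Fin (m + 1))) (i : Fin (m + 1))
    (g₂ : DSGraph (Fin n)) (h : DSGraph (Fin (m + n))) : Prop where
  inner_inner : ∀ a b, h.adj (inner i a) (inner i b) ↔ g₂.adj a b
  outer_outer : ∀ (j : Fin (m + 1)) (hj : j ≠ i) (l : Fin (m + 1)) (hl : l ≠ i),
    h.adj (outer i j hj) (outer i l hl) ↔ g₁.adj j l
  outer_inner : ∀ (j : Fin (m + 1)) (hj : j ≠ i),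
    (∃ a, h.adj (outer i j hj) (inner i a)) ↔ g₁.adj j i
  inner_outer : ∀ (j : Fin (m + 1)) (hj : j ≠ i),
    (∃ a, h.adj (inner i a) (outer i j hj)) ↔ g₁.adj i j

/-- The graphs whose sum is the partial composition `g₁ ∘ᵢ g₂` in the operad of directed simple
graphs. -/
noncomputable def insertions {m n : ℕ} (g₁ : DSGraph (Fin (m + 1))) (i : Fin (m + 1))
    (g₂ : DSGraph (Fin n)) : Finset (DSGraph (Fin (m + n))) :=
  (Set.toFinite {h | IsInsertion g₁ i g₂ h}).toFinset

end DSGraph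

/-! ### Complete Lie-graph algebras -/

/-- The Koszul sign of the permutation `σ` of `n` homogeneous elements of degrees `d`. -/
def koszulSign {n : ℕ} (σ : Equiv.Perm (Fin n)) (d : Fin n → ℤ) : ℤˣ :=
  ∏ i, ∏ j, if i < j ∧ σ j < σ i then (d i * d j).negOnePow else 1

/-- A complete `ℤ`-graded Lie-graph algebra over `𝕜`: a complete algebra over the operad of
directed simple graphs. The graded module is given as the direct sum `carrier` of its components
`gr d`, and its filtration by homogeneous submodules `fil p`, so that `F_p 𝔤_d` is
`fil p ⊓ gr d`. -/
structure CompleteLieGraphAlg (𝕜 : Type u) [Field 𝕜] where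
  carrier : Type v
  [addCommGroup : AddCommGroup carrier]
  [module : Module 𝕜 carrier]
  gr : ℤ → Submodule 𝕜 carrier
  isInternal : DirectSum.IsInternal gr
  fil : ℕ → Submodule 𝕜 carrier
  fil_zero : fil 0 = ⊤
  fil_antitone : Antitone fil
  fil_homogeneous : ∀ p, fil p = ⨆ d, fil p ⊓ gr d
  /-- In each degree, the canonical map `𝔤_d → lim_p 𝔤_d / F_p 𝔤_d` is bijective. -/
  complete : ∀ (d : ℤ) (f : ∀ p, gr d ⧸ (fil p).submoduleOf (gr d)),
    (∀ p q (hpq : p ≤ q),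
      Submodule.factor (Submodule.comap_mono (fil_antitone hpq)) (f q) = f p) →
    ∃! x : gr d, ∀ p, Submodule.Quotient.mk x = f p
  /-- The operation of a directed simple graph with `n` vertices labelled by `Fin n`. -/
  op : ∀ {n : ℕ}, DSGraph (Fin n) → MultilinearMap 𝕜 (fun _ : Fin n => carrier) carrier
  op_mem_gr : ∀ {n : ℕ} (g : DSGraph (Fin n)) (d : Fin n → ℤ) (x : Fin n → carrier),
    (∀ i, x i ∈ gr (d i)) → op g x ∈ gr (∑ i, d i)
  op_mem_fil : ∀ {n : ℕ} (g : DSGraph (Fin n)) (p : Fin n → ℕ) (x : Fin n → carrier),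
    (∀ i, x i ∈ fil (p i)) → op g x ∈ fil (∑ i, p i)
  op_unit : ∀ (g : DSGraph (Fin 1)) (x : Fin 1 → carrier), op g x = x 0
  op_relabel : ∀ {n : ℕ} (g : DSGraph (Fin n)) (σ : Equiv.Perm (Fin n)) (d : Fin n → ℤ)
    (x : Fin n → carrier), (∀ i, x i ∈ gr (d i)) →
    op (g.relabel σ) (fun i => x (σ.symm i)) = (koszulSign σ d : ℤ) • op g x
  op_comp : ∀ {m n : ℕ} (g₁ : DSGraph (Fin (m + 1))) (i : Fin (m + 1)) (g₂ : DSGraph (Fin n))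
    (x : Fin (m + n) → carrier),
    op g₁ (fun j => if hj : j = i then op g₂ (fun b => x (DSGraph.inner i b))
      else x (DSGraph.outer i j hj)) = ∑ h ∈ DSGraph.insertions g₁ i g₂, op h x

namespace CompleteLieGraphAlg

variable {𝕜 : Type u} [Field 𝕜]

attribute [instance] addCommGroup module

/-- Morphisms of complete Lie-graph algebras: linear maps of degree `0` which preserve the
filtrations and commute with all the operations. -/
@[ext]
structure Hom (A B : CompleteLieGraphAlg.{u, v} 𝕜) where
  toLinearMap : A.carrier →ₗ[𝕜] B.carrier
  map_gr : ∀ d x, x ∈ A.gr d → toLinearMap x ∈ B.gr d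
  map_fil : ∀ p x, x ∈ A.fil p → toLinearMap x ∈ B.fil p
  map_op : ∀ {n : ℕ} (g : DSGraph (Fin n)) (x : Fin n → A.carrier),
    toLinearMap (A.op g x) = B.op g (fun i => toLinearMap (x i))

instance : Category (CompleteLieGraphAlg.{u, v} 𝕜) where
  Hom := Hom
  id A := ⟨LinearMap.id, fun _ _ h => h, fun _ _ h => h, fun _ _ => rfl⟩
  comp f g := ⟨g.toLinearMap ∘ₗ f.toLinearMap, fun d x h => g.map_gr d _ (f.map_gr d x h),
    fun p x h => g.map_fil p _ (f.map_fil p x h),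
    fun γ x => by simp only [LinearMap.comp_apply, f.map_op, g.map_op]⟩

/-- The set `𝟙 + F₁𝔤₀` of formal expressions `𝟙 + x` with `x ∈ F₁𝔤₀`. -/
@[ext]
structure OnePlus (A : CompleteLieGraphAlg.{u, v} 𝕜) : Type v where
  val : A.carrier
  mem_fil : val ∈ A.fil 1
  mem_gr : val ∈ A.gr 0

/-- The element `𝟙 = 𝟙 + 0`. -/
def OnePlus.unit (A : CompleteLieGraphAlg.{u, v} 𝕜) : A.OnePlus :=
  ⟨0, zero_mem _, zero_mem _⟩

/-- The map `𝟙 + x ↦ 𝟙 + f(x)` induced by a morphism `f`. -/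
def OnePlus.map {A B : CompleteLieGraphAlg.{u, v} 𝕜} (f : A ⟶ B) (x : A.OnePlus) : B.OnePlus :=
  ⟨Hom.toLinearMap f x.val, Hom.map_fil f 1 _ x.mem_fil, Hom.map_gr f 0 _ x.mem_gr⟩

/-- `s` is the sum of the family `a` for the topology defined by the filtration: for every `p`, all
large enough finite partial sums agree with `s` modulo `F_p`. -/
def HasFilteredSum (A : CompleteLieGraphAlg.{u, v} 𝕜) {ι : Type} (a : ι → A.carrier)
    (s : A.carrier) : Prop :=
  ∀ p, ∀ᶠ T : Finset ι in atTop, s - ∑ i ∈ T, a i ∈ A.fil p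

end CompleteLieGraphAlg

/-! ### Leveled graphs -/

/-- A directed simple graph whose vertices sit on `k` levels, `0` being the bottom one; levels
strictly decrease along the edges. Levels may be empty. -/
structure LevGraph (k : ℕ) where
  size : ℕ
  graph : DSGraph (Fin size)
  level : Fin size → Fin k
  level_lt : ∀ a b, graph.adj a b → level b < level a

namespace LevGraph

variable {k : ℕ}

/-- Isomorphisms of leveled graphs: bijections between the vertices which preserve and reflect
edges and preserve levels. -/
structure Iso (g h : LevGraph k) extends Fin g.size ≃ Fin h.size where
  adj_iff : ∀ a b, h.graph.adj (toFun a) (toFun b) ↔ g.graph.adj a b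
  level_eq : ∀ a, h.level (toFun a) = g.level a

/-- The automorphisms of a leveled graph. -/
abbrev Aut (g : LevGraph k) : Type := Iso g g

def Iso.refl (g : LevGraph k) : Iso g g := ⟨Equiv.refl _, fun _ _ => Iff.rfl, fun _ => rfl⟩

def Iso.symm {g h : LevGraph k} (e : Iso g h) : Iso h g where
  toEquiv := e.toEquiv.symm
  adj_iff a b := by
    have := e.adj_iff (e.toEquiv.symm a) (e.toEquiv.symm b)
    simpa using this.symm
  level_eq a := by
    have := e.level_eq (e.toEquiv.symm a)
    simpa using this.symm

def Iso.trans {g h l : LevGraph k} (e : Iso g h) (e' : Iso h l) : Iso g l where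
  toEquiv := e.toEquiv.trans e'.toEquiv
  adj_iff a b := (e'.adj_iff _ _).trans (e.adj_iff a b)
  level_eq a := (e'.level_eq _).trans (e.level_eq a)

theorem Iso.ext {g h : LevGraph k} {e e' : Iso g h} (H : e.toEquiv = e'.toEquiv) : e = e' := by
  cases e; cases e'; simpa using H

theorem card_aut_congr {g h : LevGraph k} (e : Iso g h) : Nat.card g.Aut = Nat.card h.Aut :=
  Nat.card_congr
    { toFun := fun s => (e.symm.trans s).trans e
      invFun := fun s => (e.trans s).trans e.symm
      left_inv := fun s => Iso.ext (by ext a; simp [Iso.trans, Iso.symm])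
      right_inv := fun s => Iso.ext (by ext a; simp [Iso.trans, Iso.symm]) }

instance setoid (k : ℕ) : Setoid (LevGraph k) where
  r g h := Nonempty (Iso g h)
  iseqv := ⟨fun g => ⟨Iso.refl g⟩, fun ⟨e⟩ => ⟨e.symm⟩, fun ⟨e⟩ ⟨e'⟩ => ⟨e.trans e'⟩⟩

end LevGraph

/-- The set of `k`-leveled directed simple graphs with unlabelled vertices, i.e. of isomorphism
classes of `k`-leveled graphs. -/
abbrev UnlabelledLevGraph (k : ℕ) : Type := Quotient (LevGraph.setoid k)

namespace CompleteLieGraphAlg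

variable {𝕜 : Type u} [Field 𝕜] (A : CompleteLieGraphAlg.{u, v} 𝕜) {k : ℕ}

/-- The action `g(z₀, …, z_{k-1})` of a `k`-leveled graph, every vertex of the level `l` being
labelled by `z l`. -/
def levOp (z : Fin k → A.OnePlus) (g : LevGraph k) : A.carrier :=
  A.op g.graph (fun a => (z (g.level a)).val)

theorem levOp_congr (z : Fin k → A.OnePlus) {g h : LevGraph k} (e : LevGraph.Iso g h) :
    A.levOp z g = A.levOp z h := by
  obtain ⟨n, γ, l, hl⟩ := g
  obtain ⟨n', γ', l', hl'⟩ := h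
  obtain ⟨σ, h1, h2⟩ := e
  obtain rfl : n = n' := Fin.equiv_iff_eq.mp ⟨σ⟩
  have hγ : γ' = γ.relabel σ := by
    ext a b
    have := h1 (σ.symm a) (σ.symm b)
    simpa [DSGraph.relabel] using this
  have hlev : l' = fun a => l (σ.symm a) := by
    ext a
    have := h2 (σ.symm a)
    simpa using congrArg Fin.val this
  have := A.op_relabel γ σ (fun _ => 0) (fun a => (z (l a)).val) (fun a => (z (l a)).mem_gr)
  simp only [koszulSign, mul_zero, Int.negOnePow_zero, ite_self, Finset.prod_const_one,
    Units.val_one, one_smul] at this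
  simp only [levOp, hγ, hlev]
  exact this.symm

/-- The term `(1 / |Aut g|) g(z₀, …, z_{k-1})` associated to an unlabelled leveled graph `g`. -/
noncomputable def levTerm (z : Fin k → A.OnePlus) : UnlabelledLevGraph k → A.carrier :=
  Quotient.lift (fun g => ((Nat.card g.Aut : 𝕜))⁻¹ • A.levOp z g) <| by
    rintro g h ⟨e⟩
    simp only [LevGraph.card_aut_congr e, A.levOp_congr z e]

end CompleteLieGraphAlg

/-! ### Complete groups -/

/-- The structure of a complete group on the set `G`: a group with a descending filtration
`G = F₁G ⊇ F₂G ⊇ ⋯` by normal subgroups such that the canonical map `G → lim_p G / F_pG` is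
bijective. -/
structure CompleteGroupStr (G : Type v) extends Group G where
  fil : ℕ+ → Subgroup G
  fil_one : fil 1 = ⊤
  fil_antitone : Antitone fil
  normal : ∀ p, (fil p).Normal
  complete : ∀ f : (∀ p, G ⧸ fil p),
    (∀ p q (hpq : p ≤ q), Subgroup.quotientMapOfLE (fil_antitone hpq) (f q) = f p) →
    ∃! x : G, ∀ p, QuotientGroup.mk x = f p

/-- Complete groups. -/
structure CompleteGrp where
  carrier : Type v
  str : CompleteGroupStr carrier

namespace CompleteGrp

/-- Morphisms of complete groups: group morphisms which preserve the filtrations. -/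
@[ext]
structure Hom (G H : CompleteGrp.{v}) where
  toFun : G.carrier → H.carrier
  map_mul : ∀ x y, toFun (G.str.mul x y) = H.str.mul (toFun x) (toFun y)
  map_fil : ∀ p x, x ∈ G.str.fil p → toFun x ∈ H.str.fil p

instance : Category CompleteGrp.{v} where
  Hom := Hom
  id G := ⟨id, fun _ _ => rfl, fun _ _ h => h⟩
  comp f g := ⟨g.toFun ∘ f.toFun,
    fun x y => by simp only [Function.comp_apply, f.map_mul, g.map_mul],
    fun p x h => g.map_fil p _ (f.map_fil p x h)⟩

end CompleteGrp

/-! ### Transport of graphs along bijections of vertices -/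

namespace DSGraph

/-! Replace the weight `1 / |Aut g|` by labellings: by orbit-stabilizer, an unlabelled graph with
`n` vertices has `n! / |Aut g|` labellings, so the product is the exponential-type series `∑ 1/n! ·
labSum (Fin n)` over labelled leveled graphs. Operations with `n` inputs in `F₁` land in `F_n`, so
the series converges.

Associativity is a special case of one merging statement, `IsLevSum.comp`: for a monotone map `φ` of
levels, summing over graphs on the merged levels, with sums over graphs on each class of levels as
inputs, gives the sum over graphs on all levels. Indeed a leveled graph `s` splits uniquely: keep
the edges whose ends have the same image under `φ`, take connected components, and contract them.
Levels prevent cycles in the contraction. Conversely the operad composition produces exactly the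
graphs with prescribed components and contraction (`opZero_fibre`, `sum_opZero_labSum`). The
factorials match because the multinomial formula turns sizes of components into maps `π : Fin N →
Fin n`, and a graph with `c` components is hit by exactly `c!` of them, all with `n = c`
(`sum_inv_factorial_opZero_labSum`). Both bracketings are then the sum over 3-leveled graphs.

A zero input kills every graph using its level, and a graph on a single level has a single vertex;
this gives the unit. The product is `x + y` plus terms with at least two vertices, which are
contracting for the filtration, so inverses come from a fixed-point iteration. Since the product
respects congruence modulo `F_p`, the cosets of `𝟙 + F_p` are the classes modulo `F_p`, and
completeness of the group is that of `𝔤₀`. -/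

@[simp]
theorem relabel_relabel {U V W : Type} (e : U ≃ V) (f : V ≃ W) (g : DSGraph U) :
    (g.relabel e).relabel f = g.relabel (e.trans f) := rfl

@[simp]
theorem relabel_refl {U : Type} (g : DSGraph U) : g.relabel (Equiv.refl U) = g := rfl

theorem relabel_eq_iff {U V : Type} (e : U ≃ V) (g : DSGraph U) (h : DSGraph V) :
    g.relabel e = h ↔ ∀ a b, h.adj (e a) (e b) ↔ g.adj a b := by
  constructor
  · rintro rfl a b
    simp [relabel]
  · intro H
    ext a b
    have := H (e.symm a) (e.symm b)
    simpa [relabel] using this.symm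

theorem nonempty {V : Type} (g : DSGraph V) : Nonempty V := g.connected.nonempty

/-- Bijections between the vertices act bijectively on directed simple graphs. -/
def relabelEquiv {U V : Type} (e : U ≃ V) : DSGraph U ≃ DSGraph V where
  toFun := relabel e
  invFun := relabel e.symm
  left_inv g := by simp
  right_inv g := by simp

theorem adj_irrefl {V : Type} (g : DSGraph V) (a : V) : ¬ g.adj a a :=
  fun h => g.acyclic a (Relation.TransGen.single h)

end DSGraph

/-! ### Operations in degree 0, indexed by arbitrary finite vertex sets -/

namespace CompleteLieGraphAlg

variable {𝕜 : Type u} [Field 𝕜] (A : CompleteLieGraphAlg.{u, v} 𝕜)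

/-- The filtration of the component of degree `0`. -/
def filZero (p : ℕ) : Submodule 𝕜 (A.gr 0) := (A.fil p).submoduleOf (A.gr 0)

theorem mem_filZero {p : ℕ} {x : A.gr 0} : x ∈ A.filZero p ↔ (x : A.carrier) ∈ A.fil p := Iff.rfl

theorem filZero_antitone : Antitone A.filZero :=
  fun _ _ h => Submodule.comap_mono (A.fil_antitone h)

@[simp]
theorem filZero_zero : A.filZero 0 = ⊤ := by
  ext x; simp [mem_filZero, A.fil_zero]

/-- The operation of a directed simple graph whose vertices form an arbitrary finite type, on the
component of degree `0`. -/
noncomputable def opZero {V : Type} [Finite V] (g : DSGraph V) :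
    MultilinearMap 𝕜 (fun _ : V => A.gr 0) (A.gr 0) :=
  MultilinearMap.domDomCongr (Finite.equivFin V).symm
    (((A.op (g.relabel (Finite.equivFin V))).compLinearMap
      (fun _ => (A.gr 0).subtype)).codRestrict (A.gr 0) (fun x => by
        have := A.op_mem_gr (g.relabel (Finite.equivFin V)) (fun _ => 0) (fun i => (x i).1)
          (fun i => (x i).2)
        simpa using this))

theorem coe_opZero {V : Type} [Finite V] (g : DSGraph V) (x : V → A.gr 0) :
    (A.opZero g x : A.carrier) =
      A.op (g.relabel (Finite.equivFin V)) (fun i => (x ((Finite.equivFin V).symm i)).1) := rfl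

theorem op_relabel_zero {m n : ℕ} (e : Fin m ≃ Fin n) (g : DSGraph (Fin m))
    (x : Fin m → A.gr 0) :
    A.op (g.relabel e) (fun i => (x (e.symm i)).1) = A.op g (fun i => (x i).1) := by
  obtain rfl : m = n := Fin.equiv_iff_eq.mp ⟨e⟩
  have := A.op_relabel g e (fun _ => 0) (fun i => (x i).1) (fun i => (x i).2)
  simpa [koszulSign] using this

theorem opZero_relabel {V W : Type} [Finite V] [Finite W] (e : V ≃ W) (g : DSGraph V)
    (x : W → A.gr 0) : A.opZero (g.relabel e) x = A.opZero g (x ∘ e) := by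
  apply Subtype.ext
  rw [coe_opZero, coe_opZero]
  have := A.op_relabel_zero (((Finite.equivFin V).symm.trans e).trans (Finite.equivFin W))
    (g.relabel (Finite.equivFin V)) (fun i => x (e ((Finite.equivFin V).symm i)))
  simpa [← Equiv.trans_assoc] using this

theorem coe_opZero_fin {n : ℕ} (g : DSGraph (Fin n)) (x : Fin n → A.gr 0) :
    (A.opZero g x : A.carrier) = A.op g (fun i => (x i).1) := by
  rw [coe_opZero]
  exact A.op_relabel_zero (Finite.equivFin (Fin n)) g x

theorem opZero_mem {V : Type} [Fintype V] (g : DSGraph V) (p : V → ℕ) (x : V → A.gr 0)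
    (hx : ∀ i, x i ∈ A.filZero (p i)) : A.opZero g x ∈ A.filZero (∑ i, p i) := by
  have := A.op_mem_fil (g.relabel (Finite.equivFin V))
    (fun i => p ((Finite.equivFin V).symm i)) (fun i => (x ((Finite.equivFin V).symm i)).1)
    (fun i => hx _)
  rwa [Equiv.sum_comp (Finite.equivFin V).symm p] at this

theorem opZero_unique {V : Type} [Unique V] (g : DSGraph V) (x : V → A.gr 0) :
    A.opZero g x = x default := by
  let e : V ≃ Fin 1 := Equiv.ofUnique V (Fin 1)
  have h := A.opZero_relabel e g (x ∘ e.symm)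
  have : (x ∘ e.symm) ∘ e = x := by ext; simp
  rw [this] at h
  rw [← h]
  apply Subtype.ext
  rw [coe_opZero_fin, A.op_unit]
  simp only [Function.comp]
  congr 2

/-- Changing the inputs of an operation modulo a step of the filtration. -/
theorem opZero_sub_mem {V : Type} [Fintype V] (g : DSGraph V) (p c : ℕ) (x y : V → A.gr 0)
    (hx : ∀ i, x i ∈ A.filZero c) (hy : ∀ i, y i ∈ A.filZero c)
    (hxy : ∀ i, x i - y i ∈ A.filZero p) :
    A.opZero g x - A.opZero g y ∈ A.filZero (p + (Fintype.card V - 1) * c) := by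
  classical
  -- Telescoping: the inputs are changed from `y` to `x` one vertex at a time.
  suffices H : ∀ s : Finset V, A.opZero g (s.piecewise x y) - A.opZero g y ∈
      A.filZero (p + (Fintype.card V - 1) * c) by
    simpa using H Finset.univ
  intro s
  induction s using Finset.induction_on with
  | empty => simp
  | insert i s hi ih =>
    have key : A.opZero g ((insert i s).piecewise x y) - A.opZero g (s.piecewise x y) =
        A.opZero g (Function.update (s.piecewise x y) i (x i - y i)) := by
      rw [MultilinearMap.map_update_sub, Finset.piecewise_insert]
      congr 2
      conv_lhs => rw [← Function.update_eq_self i (s.piecewise x y)]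
      rw [Finset.piecewise_eq_of_notMem _ _ _ hi]
    rw [← sub_add_sub_cancel _ (A.opZero g (s.piecewise x y)), key]
    refine add_mem ?_ ih
    -- The changed vertex carries a difference in `F_p`; each of the other `card V - 1` vertices
    -- contributes `c`.
    have := A.opZero_mem g (Function.update (fun _ => c) i p)
      (Function.update (s.piecewise x y) i (x i - y i)) (fun j => by
        by_cases hj : j = i
        · subst hj; simpa using hxy j
        · simp only [Function.update_of_ne hj]
          by_cases hs : j ∈ s
          · simpa [Finset.piecewise_eq_of_mem _ _ _ hs] using hx j
          · simpa [Finset.piecewise_eq_of_notMem _ _ _ hs] using hy j)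
    rw [Finset.sum_update_of_mem (Finset.mem_univ i)] at this
    simpa [Finset.sum_const, Finset.card_sdiff, Finset.card_univ] using this

theorem opZero_sub_mem_of_sub_mem {V : Type} [Finite V] (g : DSGraph V) (p : ℕ)
    (x y : V → A.gr 0) (hxy : ∀ i, x i - y i ∈ A.filZero p) :
    A.opZero g x - A.opZero g y ∈ A.filZero p := by
  cases nonempty_fintype V
  simpa using A.opZero_sub_mem g p 0 x y (by simp) (by simp) hxy

theorem eq_of_forall_sub_mem {x y : A.gr 0} (h : ∀ p, x - y ∈ A.filZero p) : x = y := by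
  obtain ⟨z, -, hz⟩ := A.complete 0 (fun p => Submodule.Quotient.mk x) (fun p q hpq => rfl)
  rw [hz x fun p => rfl, hz y fun p => ((Submodule.Quotient.eq _).2 (h p)).symm]

theorem exists_limit (f : ℕ → A.gr 0) (hf : ∀ p q, p ≤ q → f q - f p ∈ A.filZero p) :
    ∃ x, ∀ p, x - f p ∈ A.filZero p := by
  obtain ⟨x, hx, -⟩ := A.complete 0 (fun p => Submodule.Quotient.mk (f p))
    (fun p q hpq => (Submodule.Quotient.eq _).2 (hf p q hpq))
  exact ⟨x, fun p => (Submodule.Quotient.eq _).1 (hx p)⟩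

end CompleteLieGraphAlg

/-! ### Insertion at one vertex, expressed through fibres of a map -/

namespace DSGraph

section Insertion

variable {m n : ℕ} (i : Fin (m + 1))

theorem inner_injective : Function.Injective (inner i : Fin n → Fin (m + n)) := by
  intro a b h
  simp only [inner, Fin.mk.injEq] at h
  exact Fin.ext (by omega)

theorem outer_injective {j l : Fin (m + 1)} (hj : j ≠ i) (hl : l ≠ i)
    (h : (outer i j hj : Fin (m + n)) = outer i l hl) : j = l := by
  have hj' := Fin.val_ne_of_ne hj
  have hl' := Fin.val_ne_of_ne hl
  unfold outer at h
  apply Fin.ext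
  split_ifs at h with h1 h2 h2 <;> simp only [Fin.mk.injEq, Fin.lt_def] at h h1 h2 <;> omega

theorem inner_ne_outer (b : Fin n) {j : Fin (m + 1)} (hj : j ≠ i) :
    inner i b ≠ outer i j hj := by
  have hj' := Fin.val_ne_of_ne hj
  intro h
  unfold outer inner at h
  split_ifs at h with h1 <;> simp only [Fin.mk.injEq, Fin.lt_def] at h h1 <;> omega

theorem eq_inner_or_eq_outer (t : Fin (m + n)) :
    (∃ b, t = inner i b) ∨ ∃ j, ∃ hj : j ≠ i, t = outer i j hj := by
  by_cases h1 : t.1 < i.1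
  · refine Or.inr ⟨⟨t, by omega⟩, ?_, ?_⟩
    · exact Fin.ne_of_val_ne (by simp; omega)
    · apply Fin.ext
      simp [outer, Fin.lt_def, h1]
  · by_cases h2 : t.1 < i.1 + n
    · exact Or.inl ⟨⟨t.1 - i.1, by omega⟩, Fin.ext (by simp [inner]; omega)⟩
    · refine Or.inr ⟨⟨t.1 + 1 - n, by omega⟩, ?_, ?_⟩
      · exact Fin.ne_of_val_ne (by simp; omega)
      · apply Fin.ext
        have : ¬ (t.1 + 1 - n < i.1) := by omega
        simp [outer, Fin.lt_def, this]
        omega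

end Insertion

/-- The relation `H` on `U` restricts to a directed simple graph on every fibre of `π`. -/
structure IsFibrewise {U V : Type} (π : U → V) (H : U → U → Prop) : Prop where
  acyclic : ∀ v, ∀ a : {u // π u = v},
    ¬ Relation.TransGen (fun a b : {u // π u = v} => H a b) a a
  connected : ∀ v, (SimpleGraph.fromRel (fun a b : {u // π u = v} => H a b)).Connected

/-- The directed simple graph on the fibre of `π` at `v`. -/
@[simps]
def fibre {U V : Type} {π : U → V} {H : U → U → Prop} (hH : IsFibrewise π H) (v : V) :
    DSGraph {u // π u = v} where
  adj a b := H a b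
  acyclic := hH.acyclic v
  connected := hH.connected v

theorem IsFibrewise.irrefl {U V : Type} {π : U → V} {H : U → U → Prop} (hH : IsFibrewise π H)
    (a : U) : ¬ H a a :=
  fun h => hH.acyclic (π a) ⟨a, rfl⟩ (Relation.TransGen.single h)

theorem IsFibrewise.surjective {U V : Type} {π : U → V} {H : U → U → Prop}
    (hH : IsFibrewise π H) : Function.Surjective π :=
  fun v => let ⟨a⟩ := (hH.connected v).nonempty; ⟨a.1, a.2⟩

/-- `G` is one of the graphs obtained by inserting in every vertex `v` of `g` the restriction of
`H` to the fibre of `π` at `v`, and by replacing every edge of `g` by edges of the same direction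
between the fibres, at least one for every edge of `g`. -/
structure IsExpansion {U V : Type} (π : U → V) (g : DSGraph V) (H : U → U → Prop)
    (G : DSGraph U) : Prop where
  inner : ∀ a b, π a = π b → (G.adj a b ↔ H a b)
  outer : ∀ v w, v ≠ w → ((∃ a b, π a = v ∧ π b = w ∧ G.adj a b) ↔ g.adj v w)

/-- The finite set of the expansions of `g`. -/
noncomputable def expansions {U V : Type} [Finite U] (π : U → V) (g : DSGraph V)
    (H : U → U → Prop) : Finset (DSGraph U) :=
  (Set.toFinite {G | IsExpansion π g H G}).toFinset

theorem mem_expansions {U V : Type} [Finite U] {π : U → V} {g : DSGraph V}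
    {H : U → U → Prop} {G : DSGraph U} : G ∈ expansions π g H ↔ IsExpansion π g H G := by
  simp [expansions]

/-- When only the fibre over `i` can be larger than a point, expanding is inserting at `i`: the four
clauses are those of `IsInsertion`, written without numerical labels. -/
theorem isExpansion_iff_of_subsingleton {U V : Type} {π : U → V} {g : DSGraph V}
    {H : U → U → Prop} (hH : IsFibrewise π H) {i : V}
    (hi : ∀ a b, π a = π b → π a ≠ i → a = b) (G : DSGraph U) :
    IsExpansion π g H G ↔ (∀ a b, π a = i → π b = i → (G.adj a b ↔ H a b)) ∧
      (∀ a b, π a ≠ i → π b ≠ i → (G.adj a b ↔ g.adj (π a) (π b))) ∧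
      (∀ a, π a ≠ i → ((∃ b, π b = i ∧ G.adj a b) ↔ g.adj (π a) i)) ∧
      (∀ a, π a ≠ i → ((∃ b, π b = i ∧ G.adj b a) ↔ g.adj i (π a))) := by
  constructor
  · rintro ⟨h1, h2⟩
    refine ⟨fun a b ha hb => h1 a b (ha.trans hb.symm), fun a b ha hb => ?_, fun a ha => ?_,
      fun a ha => ?_⟩
    · by_cases hab : π a = π b
      · obtain rfl := hi a b hab ha
        exact iff_of_false (G.adj_irrefl _) (g.adj_irrefl _)
      · rw [← h2 _ _ hab]
        refine ⟨fun h => ⟨a, b, rfl, rfl, h⟩, ?_⟩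
        rintro ⟨a', b', ha', hb', h⟩
        rwa [← hi a' a ha' (ha'.symm ▸ ha), ← hi b' b hb' (hb'.symm ▸ hb)]
    · rw [← h2 _ _ ha]
      refine ⟨fun ⟨b, hb, h⟩ => ⟨a, b, rfl, hb, h⟩, ?_⟩
      rintro ⟨a', b', ha', hb', h⟩
      exact ⟨b', hb', by rwa [← hi a' a ha' (ha'.symm ▸ ha)]⟩
    · rw [← h2 _ _ (Ne.symm ha)]
      refine ⟨fun ⟨b, hb, h⟩ => ⟨b, a, hb, rfl, h⟩, ?_⟩
      rintro ⟨a', b', ha', hb', h⟩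
      exact ⟨a', ha', by rwa [← hi b' a hb' (hb'.symm ▸ ha)]⟩
  · rintro ⟨h1, h2, h3, h4⟩
    refine ⟨fun a b hab => ?_, fun v w hvw => ?_⟩
    · by_cases ha : π a = i
      · exact h1 a b ha (hab ▸ ha)
      · obtain rfl := hi a b hab ha
        exact iff_of_false (G.adj_irrefl _) (hH.irrefl _)
    · obtain ⟨a, rfl⟩ := hH.surjective v
      obtain ⟨b, rfl⟩ := hH.surjective w
      by_cases ha : π a = i
      · have hb : π b ≠ i := fun h => hvw (ha.trans h.symm)
        rw [ha, ← h4 b hb]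
        constructor
        · rintro ⟨a', b', ha', hb', h⟩
          exact ⟨a', ha', by rwa [← hi b' b hb' (hb'.symm ▸ hb)]⟩
        · rintro ⟨a', ha', h⟩
          exact ⟨a', b, ha', rfl, h⟩
      · by_cases hb : π b = i
        · rw [hb, ← h3 a ha]
          constructor
          · rintro ⟨a', b', ha', hb', h⟩
            exact ⟨b', hb', by rwa [← hi a' a ha' (ha'.symm ▸ ha)]⟩
          · rintro ⟨b', hb', h⟩
            exact ⟨a, b', rfl, hb', h⟩
        · rw [← h2 a b ha hb]
          constructor
          · rintro ⟨a', b', ha', hb', h⟩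
            rwa [← hi a' a ha' (ha'.symm ▸ ha), ← hi b' b hb' (hb'.symm ▸ hb)]
          · intro h
            exact ⟨a, b, rfl, rfl, h⟩

end DSGraph

namespace CompleteLieGraphAlg

open DSGraph

variable {𝕜 : Type u} [Field 𝕜] (A : CompleteLieGraphAlg.{u, v} 𝕜)

/-- The operation of a graph with one vertex, in the form needed for fibres. -/
theorem opZero_of_forall_eq {V : Type} [Finite V] (g : DSGraph V) (x : V → A.gr 0) (a : V)
    (ha : ∀ b, b = a) : A.opZero g x = x a := by
  let _ : Unique V := ⟨⟨a⟩, ha⟩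
  exact A.opZero_unique g x

/-- This is the axiom `op_comp` freed from its label shifts. The one-point fibres carry the operadic
unit, so only the fibre over `i` is really composed. -/
theorem opZero_fibre_of_subsingleton {U V : Type} [Finite U] [Finite V] (π : U → V)
    (g : DSGraph V) (H : U → U → Prop) (hH : IsFibrewise π H) (i : V)
    (hi : ∀ a b, π a = π b → π a ≠ i → a = b) (x : U → A.gr 0) :
    A.opZero g (fun v => A.opZero (fibre hH v) (fun a => x a)) =
      ∑ G ∈ expansions π g H, A.opZero G x := by
  classical
  obtain ⟨m, hm⟩ : ∃ m, Nat.card V = m + 1 :=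
    Nat.exists_eq_succ_of_ne_zero (@Nat.card_pos V ⟨i⟩ _).ne'
  let eV : V ≃ Fin (m + 1) := Finite.equivFinOfCardEq hm
  obtain ⟨n, hn⟩ : ∃ n, Nat.card {u // π u = i} = n := ⟨_, rfl⟩
  let e : {u // π u = i} ≃ Fin n := Finite.equivFinOfCardEq hn
  have hne : ∀ {u}, π u ≠ i → eV (π u) ≠ eV i := fun h h' => h (eV.injective h')
  -- The numbering of `U` imposed by the label conventions of the partial composition at `eV i`.
  let E₀ : U → Fin (m + n) := fun u =>
    if h : π u = i then inner (eV i) (e ⟨u, h⟩) else outer (eV i) (eV (π u)) (hne h)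
  have hE1 : ∀ u (h : π u = i), E₀ u = inner (eV i) (e ⟨u, h⟩) := fun u h => dif_pos h
  have hE2 : ∀ u (h : π u ≠ i), E₀ u = outer (eV i) (eV (π u)) (hne h) := fun u h => dif_neg h
  have hbij : Function.Bijective E₀ := by
    constructor
    · intro a b hab
      by_cases ha : π a = i <;> by_cases hb : π b = i
      · rw [hE1 a ha, hE1 b hb] at hab
        simpa using inner_injective _ hab
      · rw [hE1 a ha, hE2 b hb] at hab
        exact absurd hab (inner_ne_outer _ _ _)
      · rw [hE2 a ha, hE1 b hb] at hab
        exact absurd hab.symm (inner_ne_outer _ _ _)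
      · rw [hE2 a ha, hE2 b hb] at hab
        exact hi a b (eV.injective (outer_injective _ _ _ hab)) ha
    · intro t
      rcases eq_inner_or_eq_outer (eV i) t with ⟨b, rfl⟩ | ⟨j, hj, rfl⟩
      · refine ⟨(e.symm b).1, ?_⟩
        rw [hE1 _ (e.symm b).2]
        simp
      · obtain ⟨u, hu⟩ := hH.surjective (eV.symm j)
        have hu' : eV (π u) = j := by simp [hu]
        subst hu'
        exact ⟨u, hE2 u fun h => hj (by rw [h])⟩
  let E : U ≃ Fin (m + n) := Equiv.ofBijective E₀ hbij
  have hE1' : ∀ u (h : π u = i), E.symm (inner (eV i) (e ⟨u, h⟩)) = u :=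
    fun u h => by rw [← hE1 u h]; exact E.symm_apply_apply u
  have hE2' : ∀ u (h : π u ≠ i), E.symm (outer (eV i) (eV (π u)) (hne h)) = u :=
    fun u h => by rw [← hE2 u h]; exact E.symm_apply_apply u
  have hE1'' : ∀ b, E.symm (inner (eV i) b) = (e.symm b).1 := fun b => by
    have := hE1' (e.symm b).1 (e.symm b).2
    simpa using this
  apply Subtype.ext
  have hleft : A.opZero g (fun v => A.opZero (fibre hH v) (fun a => x a)) =
      A.opZero (g.relabel eV)
        (fun j => A.opZero (fibre hH (eV.symm j)) (fun a => x a)) := by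
    rw [opZero_relabel]
    congr 1
    ext v
    simp only [Function.comp]
    rw [eV.symm_apply_apply]
  have hcomp := A.op_comp (g.relabel eV) (eV i) ((fibre hH i).relabel e)
    (fun t => (x (E.symm t)).1)
  rw [hleft, coe_opZero_fin]
  convert hcomp using 1
  · congr 1
    ext j
    split_ifs with hj
    · subst hj
      rw [eV.symm_apply_apply]
      have := A.opZero_relabel e (fibre hH i) (fun b => x (e.symm b))
      simp only [hE1'']
      rw [← A.coe_opZero_fin ((fibre hH i).relabel e) (fun b => x (e.symm b).1), this]
      congr 2
      ext a
      simp
    · obtain ⟨u, hu⟩ := hH.surjective (eV.symm j)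
      have hu' : j = eV (π u) := by simp [hu]
      subst hu'
      have hui : π u ≠ i := fun h => hj (by rw [h])
      rw [hE2' u hui, A.opZero_of_forall_eq _ _ ⟨u, hu⟩]
      rintro ⟨b, hb⟩
      exact Subtype.ext (hi u b (hu.trans hb.symm) hui).symm
  · rw [AddSubmonoidClass.coe_finsetSum]
    refine Finset.sum_equiv (relabelEquiv E) (fun G => ?_) (fun G _ => ?_)
    · rw [mem_expansions, isExpansion_iff_of_subsingleton hH hi]
      simp only [insertions, Set.Finite.mem_toFinset, Set.mem_ofPred_eq, relabelEquiv,
        Equiv.coe_fn_mk]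
      have hout : ∀ j, j ≠ eV i → ∃ u, π u ≠ i ∧ j = eV (π u) := by
        intro j hj
        obtain ⟨u, hu⟩ := hH.surjective (eV.symm j)
        have hu' : j = eV (π u) := by simp [hu]
        exact ⟨u, fun h => hj (by rw [hu', h]), hu'⟩
      constructor
      · rintro ⟨h1, h2, h3, h4⟩
        refine ⟨fun a b => ?_, fun j hj l hl => ?_, fun j hj => ?_, fun j hj => ?_⟩
        · simp only [relabel, hE1'']
          exact h1 _ _ (e.symm a).2 (e.symm b).2
        · obtain ⟨a, ha, rfl⟩ := hout j hj
          obtain ⟨b, hb, rfl⟩ := hout l hl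
          simpa only [relabel, hE2' a ha, hE2' b hb, eV.symm_apply_apply] using h2 a b ha hb
        · obtain ⟨a, ha, rfl⟩ := hout j hj
          simp only [relabel, hE2' a ha, hE1'', eV.symm_apply_apply]
          rw [← h3 a ha]
          refine ⟨fun ⟨b, hb⟩ => ⟨_, (e.symm b).2, hb⟩, fun ⟨b, hb, h⟩ => ⟨e ⟨b, hb⟩, ?_⟩⟩
          simpa using h
        · obtain ⟨a, ha, rfl⟩ := hout j hj
          simp only [relabel, hE2' a ha, hE1'', eV.symm_apply_apply]
          rw [← h4 a ha]
          refine ⟨fun ⟨b, hb⟩ => ⟨_, (e.symm b).2, hb⟩, fun ⟨b, hb, h⟩ => ⟨e ⟨b, hb⟩, ?_⟩⟩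
          simpa using h
      · rintro ⟨h1, h2, h3, h4⟩
        refine ⟨fun a b ha hb => ?_, fun a b ha hb => ?_, fun a ha => ?_, fun a ha => ?_⟩
        · have := h1 (e ⟨a, ha⟩) (e ⟨b, hb⟩)
          simpa [relabel, hE1''] using this
        · have := h2 _ (hne ha) _ (hne hb)
          simpa only [relabel, hE2' a ha, hE2' b hb, eV.symm_apply_apply] using this
        · have := h3 _ (hne ha)
          simp only [relabel, hE2' a ha, hE1'', eV.symm_apply_apply] at this
          rw [← this]
          refine ⟨fun ⟨b, hb, h⟩ => ⟨e ⟨b, hb⟩, ?_⟩, fun ⟨b, hb⟩ => ⟨_, (e.symm b).2, hb⟩⟩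
          simpa using h
        · have := h4 _ (hne ha)
          simp only [relabel, hE2' a ha, hE1'', eV.symm_apply_apply] at this
          rw [← this]
          refine ⟨fun ⟨b, hb, h⟩ => ⟨e ⟨b, hb⟩, ?_⟩, fun ⟨b, hb⟩ => ⟨_, (e.symm b).2, hb⟩⟩
          simpa using h
    · have := A.opZero_relabel E G (fun t => x (E.symm t))
      simp only [relabelEquiv, Equiv.coe_fn_mk]
      rw [← A.coe_opZero_fin (G.relabel E) (fun t => x (E.symm t)), this]
      congr 2
      ext a
      simp

end CompleteLieGraphAlg

/-! ### Contraction, transitivity of expansions and simultaneous composition -/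

theorem connected_fromRel_of_surjective {X Y : Type} {R : X → X → Prop} {S : Y → Y → Prop}
    {f : X → Y} (hf : Function.Surjective f) (h : ∀ a b, R a b → f a = f b ∨ S (f a) (f b))
    (hR : (SimpleGraph.fromRel R).Connected) : (SimpleGraph.fromRel S).Connected := by
  have key : ∀ a b, (SimpleGraph.fromRel R).Adj a b →
      (SimpleGraph.fromRel S).Reachable (f a) (f b) := by
    intro a b hab
    by_cases hfab : f a = f b
    · rw [hfab]
    · rw [SimpleGraph.fromRel_adj] at hab
      refine SimpleGraph.Adj.reachable ?_
      rw [SimpleGraph.fromRel_adj]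
      refine ⟨hfab, ?_⟩
      rcases hab.2 with h' | h'
      · exact Or.inl ((h _ _ h').resolve_left hfab)
      · exact Or.inr ((h _ _ h').resolve_left (Ne.symm hfab))
  have key' : ∀ a b, (SimpleGraph.fromRel R).Walk a b →
      (SimpleGraph.fromRel S).Reachable (f a) (f b) := by
    intro a b w
    induction w with
    | nil => exact SimpleGraph.Reachable.refl _
    | cons hab _ ih => exact (key _ _ hab).trans ih
  have := hR.nonempty.map f
  refine ⟨fun v w => ?_⟩
  obtain ⟨a, rfl⟩ := hf v
  obtain ⟨b, rfl⟩ := hf w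
  obtain ⟨p⟩ := hR.preconnected a b
  exact key' a b p

/-- A cycle that leaves its initial fibre projects, after dropping constant steps, to a cycle of
`S`; one that never leaves it is a cycle in that fibre. -/
theorem acyclic_of_fibres {X Y : Type} {R : X → X → Prop} {S : Y → Y → Prop} (f : X → Y)
    (hS : ∀ y, ¬ Relation.TransGen S y y) (hR : ∀ a b, R a b → f a ≠ f b → S (f a) (f b))
    (hfib : ∀ y, ∀ a : {x // f x = y},
      ¬ Relation.TransGen (fun a b : {x // f x = y} => R a b) a a) (a : X) :
    ¬ Relation.TransGen R a a := by
  have key : ∀ b, Relation.TransGen R a b → Relation.TransGen S (f a) (f b) ∨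
      ∃ h : f b = f a, Relation.TransGen (fun a' b' : {x // f x = f a} => R a' b')
        ⟨a, rfl⟩ ⟨b, h⟩ := by
    intro b hab
    induction hab with
    | @single b hab =>
      by_cases h : f a = f b
      · exact Or.inr ⟨h.symm, Relation.TransGen.single hab⟩
      · exact Or.inl (Relation.TransGen.single (hR _ _ hab h))
    | @tail b c _ hbc ih =>
      by_cases h : f b = f c
      · rcases ih with ih | ⟨h', ih⟩
        · exact Or.inl (h ▸ ih)
        · exact Or.inr ⟨h.symm.trans h', ih.tail hbc⟩
      · rcases ih with ih | ⟨h', -⟩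
        · exact Or.inl (ih.tail (hR _ _ hbc h))
        · exact Or.inl (Relation.TransGen.single (h' ▸ hR _ _ hbc h))
  intro h
  rcases key a h with h' | ⟨_, h'⟩
  · exact hS _ h'
  · exact hfib _ _ h'

namespace DSGraph

section Transitivity

variable {U V' V : Type} {q : U → V'} {r : V' → V} {H : U → U → Prop}

/-- The image of a relation under `q`, without its loops. -/
def pushRel (q : U → V') (H : U → U → Prop) (v w : V') : Prop :=
  v ≠ w ∧ ∃ a b, q a = v ∧ q b = w ∧ H a b

/-- `hinj` says that over each point of `V`, either `q` takes a single value or it is injective. The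
contracted fibre is thus a point or a copy of the original one; for a general `q` it could acquire
cycles. -/
theorem IsFibrewise.pushRel (hH : IsFibrewise (r ∘ q) H) (hq : Function.Surjective q)
    (hinj : ∀ a b, r (q a) = r (q b) → q a ≠ q b → ∀ a', q a' = q a → a' = a) :
    IsFibrewise r (pushRel q H) := by
  refine ⟨fun v w hw => ?_, fun v => ?_⟩
  · obtain ⟨s, hs⟩ := hq.hasRightInverse
    refine hH.acyclic v ⟨s w, by simp [hs w.1, w.2]⟩ ?_
    refine Relation.TransGen.lift (fun w : {w // r w = v} =>
      (⟨s w, by simp [hs w.1, w.2]⟩ : {u // (r ∘ q) u = v})) ?_ _ _ hw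
    rintro ⟨w₁, h₁⟩ ⟨w₂, h₂⟩ ⟨hne, a, b, ha, hb, hab⟩
    simp only at hne ha hb ⊢
    have h1 : s w₁ = a := hinj a b (by rw [ha, hb, h₁, h₂]) (by rwa [ha, hb]) _ (by rw [hs, ha])
    have h2 : s w₂ = b := hinj b a (by rw [ha, hb, h₁, h₂]) (by rw [ha, hb]; exact hne.symm) _
      (by rw [hs, hb])
    simpa only [Function.onFun, h1, h2] using hab
  · refine connected_fromRel_of_surjective
      (f := fun a : {u // (r ∘ q) u = v} => (⟨q a, a.2⟩ : {w // r w = v})) ?_ ?_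
      (hH.connected v)
    · rintro ⟨w, hw⟩
      obtain ⟨u, rfl⟩ := hq w
      exact ⟨⟨u, hw⟩, rfl⟩
    · rintro ⟨a, ha⟩ ⟨b, hb⟩ hab
      by_cases h : q a = q b
      · exact Or.inl (Subtype.ext h)
      · exact Or.inr ⟨h, a, b, rfl, rfl, hab⟩

/-- The contraction of the fibres of `q` in an expansion of a graph `g`. -/
def IsExpansion.contract {g : DSGraph V} {G : DSGraph U} (hG : IsExpansion (r ∘ q) g H G)
    (hq : Function.Surjective q) (hr : IsFibrewise r (DSGraph.pushRel q H)) : DSGraph V' where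
  adj := DSGraph.pushRel q G.adj
  acyclic := by
    refine acyclic_of_fibres r g.acyclic ?_ fun v w hw => ?_
    · rintro v w ⟨-, a, b, rfl, rfl, hab⟩ hne
      exact (hG.outer _ _ hne).1 ⟨a, b, rfl, rfl, hab⟩
    · refine hr.acyclic v w (Relation.TransGen.mono ?_ _ _ hw)
      rintro ⟨w₁, h₁⟩ ⟨w₂, h₂⟩ ⟨hne, a, b, rfl, rfl, hab⟩
      exact ⟨hne, a, b, rfl, rfl, (hG.inner a b (h₁.trans h₂.symm)).1 hab⟩
  connected := by
    refine connected_fromRel_of_surjective hq (fun a b hab => ?_) G.connected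
    by_cases h : q a = q b
    · exact Or.inl h
    · exact Or.inr ⟨h, a, b, rfl, rfl, hab⟩

/-- Expansions can be done in two stages; the intermediate graph is recovered from `G` by
contracting the fibres of `q`. -/
theorem isExpansion_comp_iff {g : DSGraph V} {G : DSGraph U} (hH : IsFibrewise (r ∘ q) H)
    (hq : Function.Surjective q)
    (hinj : ∀ a b, r (q a) = r (q b) → q a ≠ q b → ∀ a', q a' = q a → a' = a) :
    IsExpansion (r ∘ q) g H G ↔
      ∃ g', IsExpansion r g (pushRel q H) g' ∧ IsExpansion q g' H G := by
  constructor
  · intro hG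
    refine ⟨hG.contract hq (hH.pushRel hq hinj), ⟨fun v w hvw => ?_, fun v w hvw => ?_⟩,
      ⟨fun a b hab => hG.inner a b (congrArg r hab), fun v w hvw => ?_⟩⟩
    · refine and_congr_right fun _ => exists_congr fun a => exists_congr fun b => ?_
      refine and_congr_right fun ha => and_congr_right fun hb => hG.inner a b ?_
      simp only [Function.comp, ha, hb, hvw]
    · rw [← hG.outer v w hvw]
      constructor
      · rintro ⟨_, _, rfl, rfl, -, a, b, rfl, rfl, hab⟩
        exact ⟨a, b, rfl, rfl, hab⟩
      · rintro ⟨a, b, rfl, rfl, hab⟩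
        exact ⟨q a, q b, rfl, rfl, fun h => hvw (congrArg r h), a, b, rfl, rfl, hab⟩
    · exact (and_iff_right hvw).symm
  · rintro ⟨g', hg', hG⟩
    refine ⟨fun a b hab => ?_, fun v w hvw => ?_⟩
    · by_cases h : q a = q b
      · exact hG.inner a b h
      · have h1 : ∀ a', q a' = q a → a' = a := hinj a b hab h
        have h2 : ∀ b', q b' = q b → b' = b := hinj b a hab.symm (Ne.symm h)
        have e1 : G.adj a b ↔ g'.adj (q a) (q b) := by
          rw [← hG.outer _ _ h]
          refine ⟨fun h => ⟨a, b, rfl, rfl, h⟩, ?_⟩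
          rintro ⟨a', b', ha, hb, hab⟩
          rwa [← h1 a' ha, ← h2 b' hb]
        rw [e1, hg'.inner _ _ hab]
        constructor
        · rintro ⟨-, a', b', ha, hb, hab⟩
          rwa [← h1 a' ha, ← h2 b' hb]
        · intro hab
          exact ⟨h, a, b, rfl, rfl, hab⟩
    · rw [← hg'.outer v w hvw]
      constructor
      · rintro ⟨a, b, rfl, rfl, hab⟩
        refine ⟨q a, q b, rfl, rfl, (hG.outer _ _ fun h => hvw (congrArg r h)).1 ?_⟩
        exact ⟨a, b, rfl, rfl, hab⟩
      · rintro ⟨v', w', rfl, rfl, hab⟩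
        obtain ⟨a, b, rfl, rfl, h⟩ := (hG.outer _ _ fun h => hvw (congrArg r h)).2 hab
        exact ⟨a, b, rfl, rfl, h⟩

theorem IsExpansion.unique {g g' : DSGraph V'} {H' : U → U → Prop} {G : DSGraph U}
    (h : IsExpansion q g H G) (h' : IsExpansion q g' H' G) : g = g' := by
  ext v w
  by_cases hvw : v = w
  · subst hvw
    exact iff_of_false (g.adj_irrefl _) (g'.adj_irrefl _)
  · rw [← h.outer v w hvw, h'.outer v w hvw]

/-- No graph is counted twice, because `G` determines the intermediate graph (`IsExpansion.unique`).
-/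
theorem sum_expansions_comp [Finite U] [Finite V'] {M : Type*} [AddCommMonoid M]
    (g : DSGraph V) (hH : IsFibrewise (r ∘ q) H) (hq : Function.Surjective q)
    (hinj : ∀ a b, r (q a) = r (q b) → q a ≠ q b → ∀ a', q a' = q a → a' = a)
    (f : DSGraph U → M) :
    ∑ g' ∈ expansions r g (pushRel q H), ∑ G ∈ expansions q g' H, f G =
      ∑ G ∈ expansions (r ∘ q) g H, f G := by
  classical
  rw [← Finset.sum_biUnion]
  · refine Finset.sum_congr ?_ fun _ _ => rfl
    ext G
    simp only [Finset.mem_biUnion, mem_expansions]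
    exact (isExpansion_comp_iff hH hq hinj).symm
  · intro g₁ _ g₂ _ hne
    refine Finset.disjoint_left.2 fun G h₁ h₂ => hne ?_
    exact (mem_expansions.1 h₁).unique (mem_expansions.1 h₂)

end Transitivity

end DSGraph

namespace CompleteLieGraphAlg

open DSGraph

variable {𝕜 : Type u} [Field 𝕜] (A : CompleteLieGraphAlg.{u, v} 𝕜)

/-- The simultaneous composition of operations. -/
theorem opZero_fibre {U V : Type} [Finite U] [Finite V] (π : U → V)
    (g : DSGraph V) (H : U → U → Prop) (hH : IsFibrewise π H) (x : U → A.gr 0) :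
    A.opZero g (fun v => A.opZero (fibre hH v) (fun a => x a)) =
      ∑ G ∈ expansions π g H, A.opZero G x := by
  classical
  -- Induction on the number of vertices whose fibre has at least two points.
  obtain ⟨N, hN⟩ : ∃ N, {v | ∃ a b, π a = v ∧ π b = v ∧ a ≠ b}.ncard = N := ⟨_, rfl⟩
  induction N using Nat.strong_induction_on generalizing U V with
  | _ N ih =>
  by_cases hi : ∃ i, i ∈ {v | ∃ a b, π a = v ∧ π b = v ∧ a ≠ b}
  swap
  · obtain ⟨i⟩ := g.nonempty
    refine A.opZero_fibre_of_subsingleton π g H hH i (fun a b hab _ => ?_) x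
    by_contra h
    exact hi ⟨π b, a, b, hab, rfl, h⟩
  obtain ⟨i, hi⟩ := hi
  -- Factor `π = r ∘ q`, where `q` collapses only the fibre over `i`, to `none`. Then `q` is a
  -- single insertion, and `i` is no longer a large fibre for `r`.
  let q : U → Option {u // π u ≠ i} := fun u => if h : π u = i then none else some ⟨u, h⟩
  let r : Option {u // π u ≠ i} → V := fun w => w.elim i fun u => π u.1
  have hq1 : ∀ u, π u = i → q u = none := fun u h => dif_pos h
  have hq2 : ∀ u (h : π u ≠ i), q u = some ⟨u, h⟩ := fun u h => dif_neg h
  have hq1' : ∀ u, q u = none ↔ π u = i := by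
    refine fun u => ⟨fun h => ?_, hq1 u⟩
    by_contra h'
    rw [hq2 u h'] at h
    cases h
  have hq2' : ∀ u w, q u = some w ↔ u = w.1 := by
    intro u w
    constructor
    · intro h
      have hu : π u ≠ i := fun h' => by rw [hq1 u h'] at h; cases h
      rw [hq2 u hu] at h
      rw [← Option.some_injective _ h]
    · rintro rfl
      exact hq2 _ w.2
  have hrq : π = r ∘ q := by
    ext u
    by_cases h : π u = i
    · simp [hq1 u h, r, h]
    · simp [hq2 u h, r]
  have hqs : Function.Surjective q := by
    rintro (_ | ⟨u, hu⟩)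
    · obtain ⟨u, hu⟩ := hH.surjective i
      exact ⟨u, hq1 u hu⟩
    · exact ⟨u, hq2 u hu⟩
  have hinj : ∀ a b, r (q a) = r (q b) → q a ≠ q b → ∀ a', q a' = q a → a' = a := by
    intro a b hr hab a' ha'
    have hr' : π a = π b := by rw [hrq]; exact hr
    by_cases ha : π a = i
    · exact absurd ((hq1 a ha).trans (hq1 b (hr' ▸ ha)).symm) hab
    · rw [hq2 a ha, hq2'] at ha'
      exact ha'
  have hHrq : IsFibrewise (r ∘ q) H := hrq ▸ hH
  have hr := hHrq.pushRel hqs hinj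
  have hHq : IsFibrewise q H := by
    let e : {u // π u = i} ≃ {u // q u = none} :=
      Equiv.subtypeEquivRight fun u => (hq1' u).symm
    have hsub : ∀ w, Subsingleton {u // q u = some w} := fun w =>
      ⟨fun a b => Subtype.ext (((hq2' _ _).1 a.2).trans ((hq2' _ _).1 b.2).symm)⟩
    refine ⟨?_, ?_⟩
    · rintro (_ | w)
      · exact ((fibre hH i).relabel e).acyclic
      · intro a ha
        obtain ⟨b, -, hb⟩ := Relation.TransGen.tail'_iff.1 ha
        rw [Subsingleton.elim b a] at hb
        exact hH.irrefl _ hb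
    · rintro (_ | w)
      · exact ((fibre hH i).relabel e).connected
      · have : Nonempty {u // q u = some w} := ⟨⟨w.1, (hq2' _ _).2 rfl⟩⟩
        exact ⟨fun a b => by rw [Subsingleton.elim a b]⟩
  set y : Option {u // π u ≠ i} → A.gr 0 :=
    fun w => A.opZero (fibre hHq w) (fun a => x a) with hy
  have hy2 : ∀ w, y (some w) = x w.1 := by
    intro w
    rw [hy]
    refine A.opZero_of_forall_eq (fibre hHq (some w)) (fun a => x a)
      ⟨w.1, (hq2' _ _).2 rfl⟩ ?_
    rintro ⟨b, hb⟩
    exact Subtype.ext ((hq2' _ _).1 hb)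
  have hlt : {v | ∃ a b, r a = v ∧ r b = v ∧ a ≠ b}.ncard < N := by
    rw [← hN]
    refine Set.ncard_lt_ncard (Set.ssubset_iff_subset_ne.2 ⟨?_, fun h => ?_⟩) (Set.toFinite _)
    · rintro v ⟨a, b, ha, hb, hab⟩
      obtain ⟨a, rfl⟩ := hqs a
      obtain ⟨b, rfl⟩ := hqs b
      exact ⟨a, b, by rw [hrq]; exact ha, by rw [hrq]; exact hb, fun h => hab (by rw [h])⟩
    · rw [← h] at hi
      obtain ⟨a, b, ha, hb, hab⟩ := hi
      have : ∀ a, r a = i → a = none := by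
        rintro (_ | w) ha
        · rfl
        · exact absurd ha w.2
      exact hab ((this a ha).trans (this b hb).symm)
  have hstep := ih _ hlt r g (pushRel q H) hr y rfl
  have hone : ∀ g', A.opZero g' y = ∑ G ∈ expansions q g' H, A.opZero G x := by
    intro g'
    refine A.opZero_fibre_of_subsingleton q g' H hHq none (fun a b hab ha => ?_) x
    obtain ⟨w, hw⟩ := Option.ne_none_iff_exists.1 ha
    rw [(hq2' a w).1 hw.symm, (hq2' b w).1 (hab.symm.trans hw.symm)]
  simp only [hone] at hstep
  rw [sum_expansions_comp g hHrq hqs hinj] at hstep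
  rw [show expansions π g H = expansions (r ∘ q) g H by rw [← hrq], ← hstep]
  -- It remains to identify the inputs: over `i` the fibre of `r` is the point `none`, which carries
  -- the collapsed operation; elsewhere the fibres of `r` and `π` coincide.
  congr 1
  ext1 v
  by_cases hv : v = i
  · subst hv
    rw [A.opZero_of_forall_eq (fibre hr v) _ ⟨none, rfl⟩]
    · let e : {u // π u = v} ≃ {u // q u = none} :=
        Equiv.subtypeEquivRight fun u => (hq1' u).symm
      have h1 : (fibre hH v).relabel e = fibre hHq none := rfl
      simp only [hy]
      rw [← h1, A.opZero_relabel]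
      rfl
    · rintro ⟨_ | w, hw⟩
      · rfl
      · exact absurd hw w.2
  · let e : {u // π u = v} ≃ {w // r w = v} :=
      { toFun := fun u => ⟨some ⟨u.1, fun h => hv (u.2.symm.trans h)⟩, u.2⟩
        invFun := fun w => match w with
          | ⟨none, h⟩ => absurd h (Ne.symm hv)
          | ⟨some u, h⟩ => ⟨u.1, h⟩
        left_inv := fun u => rfl
        right_inv := by
          rintro ⟨_ | w, hw⟩
          · exact absurd hw (Ne.symm hv)
          · rfl }
    have h1 : (fibre hH v).relabel e = fibre hr v := by
      rw [relabel_eq_iff]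
      rintro ⟨a, ha⟩ ⟨b, hb⟩
      simp only [fibre_adj, e, Equiv.coe_fn_mk]
      constructor
      · rintro ⟨-, a', b', ha', hb', hab⟩
        rwa [(hq2' _ _).1 ha', (hq2' _ _).1 hb'] at hab
      · intro hab
        refine ⟨fun h => ?_, a, b, hq2 _ _, hq2 _ _, hab⟩
        simp only [Option.some.injEq, Subtype.mk.injEq] at h
        subst h
        exact hH.irrefl _ hab
    rw [← h1, A.opZero_relabel]
    congr 1
    ext1 a
    exact (hy2 ⟨a.1, fun h => hv (a.2.symm.trans h)⟩).symm

end CompleteLieGraphAlg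

/-! ### Decomposition of leveled graphs into components and contraction -/

namespace DSGraph

/-- The labelled leveled graphs with vertex set `U`, with levels in `K` satisfying `P`. -/
noncomputable def levelings (U : Type) [Finite U] {K : Type} [Finite K] [LT K] (P : K → Prop) :
    Finset ((U → K) × DSGraph U) :=
  (Set.toFinite {p : (U → K) × DSGraph U |
    (∀ u, P (p.1 u)) ∧ ∀ a b, p.2.adj a b → p.1 b < p.1 a}).toFinset

theorem mem_levelings {U : Type} [Finite U] {K : Type} [Finite K] [LT K] {P : K → Prop}
    {p : (U → K) × DSGraph U} : p ∈ levelings U P ↔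
      (∀ u, P (p.1 u)) ∧ ∀ a b, p.2.adj a b → p.1 b < p.1 a := by
  simp [levelings]

section Glue

variable {U V K J : Type}

/-- The levels on `U` obtained from levels on the fibres of `π`. -/
def glueLevel {π : U → V} (r : ∀ v, ({u // π u = v} → K) × DSGraph {u // π u = v}) (u : U) : K :=
  (r (π u)).1 ⟨u, rfl⟩

/-- The relation on `U` obtained from graphs on the fibres of `π`. -/
def glueRel {π : U → V} (r : ∀ v, ({u // π u = v} → K) × DSGraph {u // π u = v}) (a b : U) :
    Prop :=
  ∃ h : π a = π b, (r (π b)).2.adj ⟨a, h⟩ ⟨b, rfl⟩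

theorem glueLevel_coe {π : U → V} (r : ∀ v, ({u // π u = v} → K) × DSGraph {u // π u = v})
    {v : V} (a : {u // π u = v}) : glueLevel r a = (r v).1 a := by
  obtain ⟨a, rfl⟩ := a
  rfl

theorem glueRel_coe {π : U → V} (r : ∀ v, ({u // π u = v} → K) × DSGraph {u // π u = v})
    {v : V} (a b : {u // π u = v}) : glueRel r a b ↔ (r v).2.adj a b := by
  obtain ⟨a, ha⟩ := a
  obtain ⟨b, rfl⟩ := b
  exact ⟨fun ⟨_, h⟩ => h, fun h => ⟨ha, h⟩⟩

theorem isFibrewise_glueRel {π : U → V}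
    (r : ∀ v, ({u // π u = v} → K) × DSGraph {u // π u = v}) : IsFibrewise π (glueRel r) := by
  have h : ∀ v, (fun a b : {u // π u = v} => glueRel r a b) = (r v).2.adj := fun v => by
    ext a b
    exact glueRel_coe r a b
  exact ⟨fun v => by rw [h]; exact (r v).2.acyclic, fun v => by rw [h]; exact (r v).2.connected⟩

theorem fibre_glueRel {π : U → V} (r : ∀ v, ({u // π u = v} → K) × DSGraph {u // π u = v})
    (v : V) : fibre (isFibrewise_glueRel r) v = (r v).2 := by
  ext a b
  exact glueRel_coe r a b

/-- The edges of `G` whose ends have levels identified by `φ`. -/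
def levelGraph (φ : K → J) (p : (U → K) × DSGraph U) : SimpleGraph U :=
  SimpleGraph.fromRel fun a b => φ (p.1 a) = φ (p.1 b) ∧ p.2.adj a b

theorem levelGraph_adj {φ : K → J} {p : (U → K) × DSGraph U} {a b : U} :
    (levelGraph φ p).Adj a b ↔ φ (p.1 a) = φ (p.1 b) ∧ (p.2.adj a b ∨ p.2.adj b a) := by
  rw [levelGraph, SimpleGraph.fromRel_adj]
  constructor
  · rintro ⟨-, h | h⟩
    · exact ⟨h.1, Or.inl h.2⟩
    · exact ⟨h.1.symm, Or.inr h.2⟩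
  · rintro ⟨h, h' | h'⟩
    · exact ⟨fun e => p.2.adj_irrefl _ (e ▸ h'), Or.inl ⟨h, h'⟩⟩
    · exact ⟨fun e => p.2.adj_irrefl _ (e ▸ h'), Or.inr ⟨h.symm, h'⟩⟩

theorem eq_of_levelGraph_reachable {X : Type} {φ : K → J} {p : (U → K) × DSGraph U} (f : U → X)
    (hf : ∀ a b, (levelGraph φ p).Adj a b → f a = f b) {a b : U}
    (h : (levelGraph φ p).Reachable a b) : f a = f b := by
  obtain ⟨w⟩ := h
  induction w with
  | nil => rfl
  | cons hab _ ih => exact (hf _ _ hab).trans ih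

/-- The fibres of `π` are the connected components of `levelGraph φ p`. -/
def IsComponents (φ : K → J) (p : (U → K) × DSGraph U) (π : U → V) : Prop :=
  Function.Surjective π ∧ ∀ a b, π a = π b ↔ (levelGraph φ p).Reachable a b

/-- `G` restricts to the graphs on the fibres and contracts to the graph on the base; levels on the
base are read off from any point of the nonempty fibres. -/
theorem glue_injective {φ : K → J} {π : U → V} {p p' : (V → J) × DSGraph V}
    {r r' : ∀ v, ({u // π u = v} → K) × DSGraph {u // π u = v}}
    (hr : ∀ v u, φ ((r v).1 u) = p.1 v) (hr' : ∀ v u, φ ((r' v).1 u) = p'.1 v)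
    {G : DSGraph U} (hG : IsExpansion π p.2 (glueRel r) G)
    (hG' : IsExpansion π p'.2 (glueRel r') G) (h : glueLevel r = glueLevel r') :
    p = p' ∧ r = r' := by
  have hrr : r = r' := by
    ext1 v
    refine Prod.ext ?_ ?_
    · ext a
      rw [← glueLevel_coe r, ← glueLevel_coe r', h]
    · ext a b
      rw [← glueRel_coe r, ← glueRel_coe r', ← hG.inner _ _ (a.2.trans b.2.symm),
        ← hG'.inner _ _ (a.2.trans b.2.symm)]
  subst hrr
  refine ⟨Prod.ext ?_ (hG.unique hG'), rfl⟩
  ext1 v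
  obtain ⟨u, hu⟩ := (isFibrewise_glueRel r).surjective v
  rw [← hr v ⟨u, hu⟩, ← hr' v ⟨u, hu⟩]

theorem acyclic_of_level {X : Type} [Preorder J] {R : X → X → Prop} (l : X → J)
    (h : ∀ a b, R a b → l b < l a) (a : X) : ¬ Relation.TransGen R a a := by
  have key : ∀ b, Relation.TransGen R a b → l b < l a := by
    intro b hab
    induction hab with
    | single h' => exact h _ _ h'
    | tail _ h' ih => exact (h _ _ h').trans ih
  exact fun h' => lt_irrefl _ (key a h')

variable [LinearOrder K] [PartialOrder J]

/-- Gluing leveled graphs on the fibres of `π` along a leveled graph on the base. -/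
theorem glue_spec {φ : K → J} (hφ : Monotone φ) {π : U → V} {p : (V → J) × DSGraph V}
    (hp : ∀ a b, p.2.adj a b → p.1 b < p.1 a)
    {r : ∀ v, ({u // π u = v} → K) × DSGraph {u // π u = v}}
    (hr : ∀ v, (∀ u, φ ((r v).1 u) = p.1 v) ∧ ∀ a b, (r v).2.adj a b → (r v).1 b < (r v).1 a)
    {G : DSGraph U} (hG : IsExpansion π p.2 (glueRel r) G) :
    (∀ a b, G.adj a b → glueLevel r b < glueLevel r a) ∧ IsComponents φ (glueLevel r, G) π := by
  have hlev : ∀ u, φ (glueLevel r u) = p.1 (π u) := fun u => (hr _).1 _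
  -- Edges between distinct fibres strictly lower the merged level, so they are absent from
  -- `levelGraph` and cannot join two fibres into one component.
  have hne : ∀ a b, π a ≠ π b → G.adj a b → φ (glueLevel r b) < φ (glueLevel r a) := by
    intro a b hab h
    rw [hlev, hlev]
    exact hp _ _ ((hG.outer _ _ hab).1 ⟨a, b, rfl, rfl, h⟩)
  refine ⟨fun a b hab => ?_, (isFibrewise_glueRel r).surjective, fun a b => ⟨fun h => ?_, ?_⟩⟩
  · by_cases h : π a = π b
    · obtain ⟨e, h'⟩ := (hG.inner a b h).1 hab
      have := (hr _).2 _ _ h'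
      rwa [← glueLevel_coe, ← glueLevel_coe] at this
    -- Linearity of `K` enters here: a monotone map from a linear order reflects strict
    -- inequalities.
    · exact hφ.reflect_lt (hne a b h hab)
  · obtain ⟨w⟩ := (r (π b)).2.connected.preconnected ⟨a, h⟩ ⟨b, rfl⟩
    refine ⟨w.map (G' := levelGraph φ (glueLevel r, G)) ⟨Subtype.val, ?_⟩⟩
    rintro ⟨c, hc⟩ ⟨d, hd⟩ hcd
    rw [SimpleGraph.fromRel_adj] at hcd
    rw [levelGraph_adj]
    refine ⟨by rw [hlev, hlev, hc, hd], ?_⟩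
    rcases hcd.2 with h' | h'
    · exact Or.inl ((hG.inner c d (hc.trans hd.symm)).2
        ((glueRel_coe r ⟨c, hc⟩ ⟨d, hd⟩).2 h'))
    · exact Or.inr ((hG.inner d c (hd.trans hc.symm)).2
        ((glueRel_coe r ⟨d, hd⟩ ⟨c, hc⟩).2 h'))
  · refine eq_of_levelGraph_reachable π fun a b hab => ?_
    rw [levelGraph_adj] at hab
    by_contra h
    rcases hab.2 with h' | h'
    · exact (hne a b h h').ne hab.1.symm
    · exact (hne b a (Ne.symm h) h').ne hab.1

/-- Every leveled graph is glued from its components and from the graph obtained by contracting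
them. -/
theorem exists_glue {φ : K → J} (hφ : Monotone φ) {π : U → V} {s : (U → K) × DSGraph U}
    (hs : ∀ a b, s.2.adj a b → s.1 b < s.1 a) (hπ : IsComponents φ s π) :
    ∃ (p : (V → J) × DSGraph V) (r : ∀ v, ({u // π u = v} → K) × DSGraph {u // π u = v}),
      (∀ a b, p.2.adj a b → p.1 b < p.1 a) ∧
      (∀ v, (∀ u, φ ((r v).1 u) = p.1 v) ∧ ∀ a b, (r v).2.adj a b → (r v).1 b < (r v).1 a) ∧
      IsExpansion π p.2 (glueRel r) s.2 ∧ glueLevel r = s.1 := by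
  obtain ⟨hsurj, hker⟩ := hπ
  obtain ⟨σ, hσ⟩ := hsurj.hasRightInverse
  have hl : ∀ u, φ (s.1 (σ (π u))) = φ (s.1 u) := fun u =>
    eq_of_levelGraph_reachable (fun u => φ (s.1 u)) (fun a b hab => (levelGraph_adj.1 hab).1)
      ((hker _ _).1 (hσ (π u)))
  -- An edge with ends of equal merged level would put them in the same component. This strict
  -- decrease makes the contracted graph acyclic.
  have hlt : ∀ a b, π a ≠ π b → s.2.adj a b → φ (s.1 b) < φ (s.1 a) := by
    intro a b hab h
    refine lt_of_le_of_ne (hφ (hs a b h).le) fun e => hab ((hker a b).2 ?_)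
    exact SimpleGraph.Adj.reachable (levelGraph_adj.2 ⟨e.symm, Or.inl h⟩)
  have hg : ∀ v w, pushRel π s.2.adj v w → φ (s.1 (σ w)) < φ (s.1 (σ v)) := by
    rintro v w ⟨hvw, a, b, rfl, rfl, hab⟩
    rw [hl, hl]
    exact hlt a b hvw hab
  let g : DSGraph V :=
    { adj := pushRel π s.2.adj
      acyclic := acyclic_of_level _ hg
      connected := by
        refine connected_fromRel_of_surjective hsurj (fun a b hab => ?_) s.2.connected
        by_cases h : π a = π b
        · exact Or.inl h
        · exact Or.inr ⟨h, a, b, rfl, rfl, hab⟩ }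
  let h : ∀ v, DSGraph {u // π u = v} := fun v =>
    { adj := fun a b => s.2.adj a b
      acyclic := acyclic_of_level (fun a => s.1 a.1) fun a b hab => hs _ _ hab
      connected := by
        have key : ∀ a b, (levelGraph φ s).Walk a b → ∀ (ha : π a = v) (hb : π b = v),
            (SimpleGraph.fromRel (fun a b : {u // π u = v} => s.2.adj a b)).Reachable
              ⟨a, ha⟩ ⟨b, hb⟩ := by
          intro a b w
          induction w with
          | nil => exact fun _ _ => SimpleGraph.Reachable.refl _
          | @cons a c _ hac _ ih =>
            intro ha hb
            have hc : π c = v := ha ▸ ((hker a c).2 hac.reachable).symm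
            refine SimpleGraph.Reachable.trans (SimpleGraph.Adj.reachable ?_) (ih hc hb)
            rw [SimpleGraph.fromRel_adj]
            exact ⟨fun e => hac.ne (congrArg Subtype.val e), (levelGraph_adj.1 hac).2⟩
        have : Nonempty {u // π u = v} := ⟨⟨σ v, hσ v⟩⟩
        refine ⟨fun a b => ?_⟩
        obtain ⟨w⟩ := (hker a b).1 (a.2.trans b.2.symm)
        exact key _ _ w a.2 b.2 }
  refine ⟨(fun v => φ (s.1 (σ v)), g), fun v => (fun u => s.1 u, h v), hg, fun v => ⟨?_, ?_⟩,
    ⟨fun a b hab => ?_, fun v w hvw => ?_⟩, rfl⟩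
  · rintro ⟨u, rfl⟩
    exact (hl u).symm
  · exact fun a b hab => hs _ _ hab
  · exact ⟨fun h => ⟨hab, h⟩, fun h => h.2⟩
  · exact (and_iff_right hvw).symm

end Glue

end DSGraph

namespace CompleteLieGraphAlg

open DSGraph

variable {𝕜 : Type u} [Field 𝕜] (A : CompleteLieGraphAlg.{u, v} 𝕜)

/-- The sum of the actions of all labelled leveled graphs with vertex set `U` and with levels
satisfying `P`. -/
noncomputable def labSum (U : Type) [Finite U] {K : Type} [Finite K] [LT K] (P : K → Prop)
    (Z : K → A.gr 0) : A.gr 0 :=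
  ∑ p ∈ levelings U P, A.opZero p.2 (fun u => Z (p.1 u))

theorem labSum_congr {U W : Type} [Finite U] [Finite W] (e : U ≃ W) {K : Type} [Finite K] [LT K]
    (P : K → Prop) (Z : K → A.gr 0) : A.labSum U P Z = A.labSum W P Z := by
  refine Finset.sum_equiv ((e.arrowCongr (Equiv.refl K)).prodCongr (relabelEquiv e))
    (fun p => ?_) (fun p _ => ?_)
  · simp only [mem_levelings, Equiv.prodCongr_apply, Prod.map, Equiv.arrowCongr_apply,
      Function.comp, relabelEquiv, Equiv.coe_fn_mk, relabel, Equiv.refl_apply]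
    refine and_congr ?_ ?_
    · exact (Equiv.forall_congr_right (q := fun u => P (p.1 u)) e.symm).symm
    · constructor
      · exact fun h a b hab => h _ _ hab
      · intro h a b hab
        simpa using h (e a) (e b) (by simpa using hab)
  · simp only [Equiv.prodCongr_apply, Prod.map, relabelEquiv, Equiv.coe_fn_mk]
    rw [A.opZero_relabel]
    congr 1
    ext u
    simp [Function.comp]

/-- Composing sums over leveled graphs along `π` gives the sum over the leveled graphs whose
components are the fibres of `π`. -/
theorem sum_opZero_labSum {U V K J : Type} [Finite U] [Finite V] [Finite K] [Finite J]
    [LinearOrder K] [PartialOrder J] {φ : K → J} (hφ : Monotone φ) (π : U → V)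
    (Z : K → A.gr 0) :
    ∑ p ∈ levelings V (fun _ : J => True),
      A.opZero p.2 (fun v => A.labSum {u // π u = v} (fun k => φ k = p.1 v) Z) =
    ∑ s ∈ (Set.toFinite {s | s ∈ levelings U (fun _ : K => True) ∧
      IsComponents φ s π}).toFinset, A.opZero s.2 (fun u => Z (s.1 u)) := by
  classical
  cases nonempty_fintype V
  have hexp : ∀ (p : (V → J) × DSGraph V)
      (r : ∀ v, ({u // π u = v} → K) × DSGraph {u // π u = v}),
      A.opZero p.2 (fun v => A.opZero (r v).2 (fun u => Z ((r v).1 u))) =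
        ∑ G ∈ expansions π p.2 (glueRel r), A.opZero G (fun u => Z (glueLevel r u)) := by
    intro p r
    rw [← A.opZero_fibre π p.2 _ (isFibrewise_glueRel r)]
    congr 1
    ext1 v
    rw [fibre_glueRel]
    congr 1
    ext1 u
    rw [glueLevel_coe]
  simp only [labSum, MultilinearMap.map_sum_finset, hexp]
  simp only [Finset.sum_sigma']
  -- Gluing is a bijection from triples (base, graphs on the fibres, expansion) to leveled graphs
  -- with components the fibres of `π`.
  refine Finset.sum_bij (fun x _ => (glueLevel x.2.1, x.2.2)) ?_ ?_ ?_ ?_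
  · rintro ⟨p, r, G⟩ hx
    simp only [Finset.mem_sigma, mem_levelings, Fintype.mem_piFinset, mem_expansions] at hx
    obtain ⟨⟨-, hp⟩, hr, hG⟩ := hx
    obtain ⟨h1, h2⟩ := glue_spec hφ hp hr hG
    simp only [Set.Finite.mem_toFinset, Set.mem_ofPred_eq, mem_levelings]
    exact ⟨⟨fun _ => trivial, h1⟩, h2⟩
  · rintro ⟨p, r, G⟩ hx ⟨p', r', G'⟩ hx' h
    simp only [Finset.mem_sigma, mem_levelings, Fintype.mem_piFinset, mem_expansions] at hx hx'
    simp only [Prod.mk.injEq] at h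
    obtain ⟨h, rfl⟩ := h
    obtain ⟨rfl, rfl⟩ := glue_injective (fun v => (hx.2.1 v).1) (fun v => (hx'.2.1 v).1)
      hx.2.2 hx'.2.2 h
    rfl
  · rintro s hs
    simp only [Set.Finite.mem_toFinset, Set.mem_ofPred_eq, mem_levelings] at hs
    obtain ⟨p, r, hp, hr, hG, hl⟩ := exists_glue hφ hs.1.2 hs.2
    refine ⟨⟨p, r, s.2⟩, ?_, Prod.ext hl rfl⟩
    simp only [Finset.mem_sigma, mem_levelings, Fintype.mem_piFinset, mem_expansions]
    exact ⟨⟨fun _ => trivial, hp⟩, hr, hG⟩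
  · intro x _
    rfl

end CompleteLieGraphAlg

/-! ### Counting identities for the factorial weights -/

/-- Functions to `V` grouped according to the cardinalities of their fibres. -/
theorem inv_factorial_smul_sum_fibre_card {𝕜 : Type*} [Field 𝕜] [CharZero 𝕜] {M : Type*}
    [AddCommGroup M] [Module 𝕜 M] {V : Type} [Fintype V] [DecidableEq V] (N : ℕ)
    (Y : (V → ℕ) → M) :
    ((N.factorial : 𝕜))⁻¹ • ∑ π : Fin N → V, Y (fun v => Nat.card {i // π i = v}) =
      ∑ m ∈ Finset.piAntidiag Finset.univ N, (∏ v, ((m v).factorial : 𝕜)⁻¹) • Y m := by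
  -- `Λ` sends the monomial with exponent `m` to `Y m`. Applied to the two expansions of `(∑
  -- X_v)^N`, over functions and by multinomial coefficients, it gives the identity.
  let Λ : MvPolynomial V 𝕜 →ₗ[𝕜] M :=
    (MvPolynomial.basisMonomials V 𝕜).constr 𝕜 (fun m => Y m)
  have hΛ : ∀ m : V → ℕ, Λ (∏ v, MvPolynomial.X v ^ m v) = Y m := by
    intro m
    have h := (MvPolynomial.basisMonomials V 𝕜).constr_basis 𝕜 (fun m : V →₀ ℕ => Y m)
      (Finsupp.equivFunOnFinite.symm m)
    rw [MvPolynomial.coe_basisMonomials] at h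
    have h' : MvPolynomial.monomial (Finsupp.equivFunOnFinite.symm m) (1 : 𝕜) =
        ∏ v, MvPolynomial.X v ^ m v := by
      rw [MvPolynomial.monomial_eq, Finsupp.prod_fintype _ _ (by simp)]
      simp
    rw [← h']
    exact h
  have key := (Fintype.sum_pow (fun v : V => (MvPolynomial.X v : MvPolynomial V 𝕜)) N).symm.trans
    (Finset.sum_pow_eq_sum_piAntidiag Finset.univ
      (fun v : V => (MvPolynomial.X v : MvPolynomial V 𝕜)) N)
  have hfib : ∀ π : Fin N → V, ∏ i, (MvPolynomial.X (π i) : MvPolynomial V 𝕜) =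
      ∏ v, MvPolynomial.X v ^ Nat.card {i // π i = v} := by
    intro π
    rw [← Finset.prod_fiberwise' (s := Finset.univ) π]
    refine Finset.prod_congr rfl fun v _ => ?_
    rw [Finset.prod_const, Nat.card_eq_fintype_card, Fintype.card_subtype]
  have key' := congrArg Λ key
  simp only [hfib, map_sum, hΛ] at key'
  rw [key', Finset.smul_sum]
  refine Finset.sum_congr rfl fun m hm => ?_
  rw [← nsmul_eq_mul, map_nsmul, hΛ, ← Nat.cast_smul_eq_nsmul 𝕜, smul_smul]
  congr 1
  have hsum := (Finset.mem_piAntidiag.1 hm).1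
  have h := Nat.multinomial_spec Finset.univ m
  rw [hsum] at h
  rw [← h, Finset.prod_inv_distrib]
  have h1 : (∏ v, ((m v).factorial : 𝕜)) ≠ 0 :=
    Finset.prod_ne_zero_iff.2 fun v _ => Nat.cast_ne_zero.2 (Nat.factorial_ne_zero _)
  have h2 : (Nat.multinomial Finset.univ m : 𝕜) ≠ 0 :=
    Nat.cast_ne_zero.2 (Nat.multinomial_pos _ _).ne'
  push_cast
  field_simp

/-- Surjections with given kernel are bijections from the quotient. -/
noncomputable def surjectiveKerEquiv {U V : Type} (s : Setoid U) :
    {π : U → V // Function.Surjective π ∧ ∀ a b, π a = π b ↔ s a b} ≃ (Quotient s ≃ V) where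
  toFun π := Equiv.ofBijective (Quotient.lift π.1 fun a b h => (π.2.2 a b).2 h) <| by
    constructor
    · rintro ⟨a⟩ ⟨b⟩ h
      exact Quotient.sound ((π.2.2 a b).1 h)
    · intro v
      obtain ⟨u, hu⟩ := π.2.1 v
      exact ⟨Quotient.mk s u, hu⟩
  invFun e := ⟨fun u => e (Quotient.mk s u), e.surjective.comp Quotient.mk_surjective,
    fun a b => e.injective.eq_iff.trans Quotient.eq⟩
  left_inv π := rfl
  right_inv e := by
    ext x
    obtain ⟨u, rfl⟩ := Quotient.mk_surjective x
    rfl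

/-- Only `n` equal to the number `c` of classes contributes, with `c!` bijections from the quotient;
`hp` ensures that `c` lies in the range. -/
theorem sum_inv_factorial_mul_card_surjectiveKer {𝕜 : Type*} [Field 𝕜] [CharZero 𝕜] {U : Type}
    [Finite U] (s : Setoid U) {p : ℕ} (hp : Nat.card U < p) :
    ∑ n ∈ Finset.range p, ((n.factorial : 𝕜))⁻¹ * (Nat.card {π : U → Fin n //
      Function.Surjective π ∧ ∀ a b, π a = π b ↔ s a b} : 𝕜) = 1 := by
  have hc : Nat.card (Quotient s) < p :=
    (Nat.card_le_card_of_surjective _ Quotient.mk_surjective).trans_lt hp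
  rw [Finset.sum_eq_single_of_mem (Nat.card (Quotient s)) (Finset.mem_range.2 hc)]
  · rw [Nat.card_congr (surjectiveKerEquiv s), Nat.card_congr
      (Equiv.equivCongr (Equiv.refl (Quotient s)) (Finite.equivFin (Quotient s)).symm)]
    have : Nat.card (Equiv.Perm (Quotient s)) = (Nat.card (Quotient s)).factorial := Nat.card_perm
    rw [this]
    exact inv_mul_cancel₀ (Nat.cast_ne_zero.2 (Nat.factorial_ne_zero _))
  · intro n _ hn
    have : IsEmpty (Quotient s ≃ Fin n) :=
      ⟨fun e => hn (by rw [Nat.card_congr e, Nat.card_eq_fintype_card, Fintype.card_fin])⟩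
    rw [Nat.card_congr (surjectiveKerEquiv s), Nat.card_of_isEmpty]
    simp

/-! ### Series over labelled leveled graphs and merging of levels -/

namespace CompleteLieGraphAlg

open DSGraph

variable {𝕜 : Type u} [Field 𝕜] (A : CompleteLieGraphAlg.{u, v} 𝕜)

section LevSum

variable {K : Type} [Finite K] [LT K] (P : K → Prop) (Z : K → A.gr 0)

theorem labSum_mem (hZ : ∀ k, Z k ∈ A.filZero 1) (U : Type) [Finite U] :
    A.labSum U P Z ∈ A.filZero (Nat.card U) := by
  cases nonempty_fintype U
  refine sum_mem fun p _ => ?_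
  have := A.opZero_mem p.2 (fun _ => 1) (fun u => Z (p.1 u)) (fun u => hZ _)
  simpa using this

/-- The sum of the terms of the labelled leveled graphs with less than `p` vertices. -/
noncomputable def truncSum (p : ℕ) : A.gr 0 :=
  ∑ n ∈ Finset.range p, ((n.factorial : 𝕜))⁻¹ • A.labSum (Fin n) P Z

/-- `s` is the sum of the terms of all labelled leveled graphs with levels satisfying `P`. -/
def IsLevSum (s : A.gr 0) : Prop := ∀ p, s - A.truncSum P Z p ∈ A.filZero p

theorem exists_isLevSum (hZ : ∀ k, Z k ∈ A.filZero 1) : ∃ s, A.IsLevSum P Z s := by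
  refine A.exists_limit _ fun p q hpq => ?_
  rw [truncSum, truncSum, ← Finset.sum_range_add_sum_Ico _ hpq, add_sub_cancel_left]
  refine sum_mem fun n hn => Submodule.smul_mem _ _ ?_
  have := A.labSum_mem P Z hZ (Fin n)
  rw [Nat.card_eq_fintype_card, Fintype.card_fin] at this
  exact A.filZero_antitone (Finset.mem_Ico.1 hn).1 this

variable {A P Z} in
theorem IsLevSum.unique {s t : A.gr 0} (hs : A.IsLevSum P Z s) (ht : A.IsLevSum P Z t) :
    s = t :=
  A.eq_of_forall_sub_mem fun p => by simpa using sub_mem (hs p) (ht p)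

variable {A P Z} in
theorem IsLevSum.congr {K' : Type} [Finite K'] [LT K'] {P' : K' → Prop} {Z' : K' → A.gr 0}
    (h : ∀ n, A.labSum (Fin n) P Z = A.labSum (Fin n) P' Z') {s : A.gr 0}
    (hs : A.IsLevSum P Z s) : A.IsLevSum P' Z' s := by
  simpa only [IsLevSum, truncSum, h] using hs

/-- Since levels may be empty, only the order on the levels satisfying `P` matters. -/
theorem labSum_of_embedding {K' : Type} [Finite K'] [LT K'] (ι : K' → K)
    (hι : Function.Injective ι) (hlt : ∀ a b, ι a < ι b ↔ a < b) (hP : ∀ k, P k ↔ ∃ a, ι a = k)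
    (U : Type) [Finite U] :
    A.labSum U P Z = A.labSum U (fun _ : K' => True) (fun a => Z (ι a)) := by
  refine (Finset.sum_bij (fun p _ => (fun u => ι (p.1 u), p.2)) ?_ ?_ ?_ ?_).symm
  · rintro ⟨l, g⟩ hp
    rw [mem_levelings] at hp ⊢
    exact ⟨fun u => (hP _).2 ⟨_, rfl⟩, fun a b hab => (hlt _ _).2 (hp.2 a b hab)⟩
  · rintro ⟨l, g⟩ _ ⟨l', g'⟩ _ h
    simp only [Prod.mk.injEq] at h
    obtain ⟨h, rfl⟩ := h
    congr 1
    ext u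
    exact hι (congrFun h u)
  · rintro ⟨l, g⟩ hp
    rw [mem_levelings] at hp
    choose l' hl' using fun u => (hP _).1 (hp.1 u)
    obtain rfl : (fun u => ι (l' u)) = l := funext hl'
    exact ⟨(l', g), mem_levelings.2 ⟨fun _ => trivial, fun a b hab => (hlt _ _).1 (hp.2 a b hab)⟩,
      rfl⟩
  · intro p _
    rfl

end LevSum

theorem labSum_one {K : Type} [Fintype K] [LT K] (P : K → Prop) [DecidablePred P]
    (Z : K → A.gr 0) : A.labSum (Fin 1) P Z = ∑ k with P k, Z k := by
  let g : DSGraph (Fin 1) :=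
    { adj := fun _ _ => False
      acyclic := acyclic_of_level (J := ℕ) (fun _ => 0) (fun _ _ h => h.elim)
      connected := ⟨fun a b => by rw [Subsingleton.elim a b]⟩ }
  have hg : ∀ g' : DSGraph (Fin 1), g = g' := fun g' => by
    ext a b
    rw [Subsingleton.elim b a]
    exact iff_of_false (g.adj_irrefl a) (g'.adj_irrefl a)
  refine (Finset.sum_bij' (fun k _ => (fun _ => k, g)) (fun p _ => p.1 0) ?_ ?_ ?_ ?_ ?_).symm
  · intro k hk
    exact mem_levelings.2 ⟨fun _ => (Finset.mem_filter.1 hk).2, fun _ _ h => h.elim⟩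
  · intro p hp
    exact Finset.mem_filter.2 ⟨Finset.mem_univ _, (mem_levelings.1 hp).1 0⟩
  · intro k _
    rfl
  · intro p _
    refine Prod.ext (funext fun u => ?_) (hg p.2)
    rw [Subsingleton.elim u 0]
  · intro k _
    exact (A.opZero_unique g fun _ => Z k).symm

theorem labSum_zero {K : Type} [Finite K] [LT K] (P : K → Prop) (Z : K → A.gr 0) :
    A.labSum (Fin 0) P Z = 0 :=
  Finset.sum_eq_zero fun p _ => p.2.nonempty.elim fun a => a.elim0

/-- With a single available level there are no edges, so connectedness leaves only the one-vertex
graph. -/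
theorem isLevSum_of_unique {K : Type} [Finite K] [Preorder K] {P : K → Prop} {Z : K → A.gr 0}
    (hZ : ∀ k, Z k ∈ A.filZero 1) (k₀ : K) (hP : ∀ k, P k ↔ k = k₀) :
    A.IsLevSum P Z (Z k₀) := by
  have hempty : ∀ n, n ≠ 1 → A.labSum (Fin n) P Z = 0 := by
    intro n hn
    refine Finset.sum_eq_zero fun p hp => ?_
    rw [mem_levelings] at hp
    exfalso
    have hadj : ∀ a b, ¬ p.2.adj a b := fun a b hab => by
      have h := hp.2 a b hab
      rw [(hP _).1 (hp.1 a), (hP _).1 (hp.1 b)] at h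
      exact lt_irrefl _ h
    obtain ⟨c⟩ := p.2.nonempty
    have : Nontrivial (Fin n) := by
      have := c.2
      exact Fin.nontrivial_iff_two_le.2 (by omega)
    obtain ⟨d, hd⟩ := p.2.connected.preconnected.exists_adj_of_nontrivial c
    rw [SimpleGraph.fromRel_adj] at hd
    exact hd.2.elim (hadj _ _) (hadj _ _)
  have hone : A.labSum (Fin 1) P Z = Z k₀ := by
    classical
    cases nonempty_fintype K
    have : Finset.univ.filter P = {k₀} := by
      ext k
      simp [hP]
    rw [labSum_one, this, Finset.sum_singleton]
  intro p
  rcases Nat.lt_or_ge 1 p with hp | hp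
  · rw [truncSum, Finset.sum_eq_single_of_mem 1 (Finset.mem_range.2 hp), hone]
    · simp
    · intro n _ hn
      rw [hempty n hn, smul_zero]
  · rw [truncSum, Finset.sum_eq_zero, sub_zero]
    · exact A.filZero_antitone hp (hZ k₀)
    · intro n hn
      rw [hempty n (by have := Finset.mem_range.1 hn; omega), smul_zero]

/-- The part of the composite with `N` vertices in total. The weights `∏ 1/m_v!` become a sum over
maps `π : Fin N → Fin n` divided by `N!`. A leveled graph `s` occurs for those `π` whose fibres are
its components; weighted by `1/n!`, these count for one in total. A graph has at most `N`
components, so `n < p` is enough. -/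
theorem sum_inv_factorial_opZero_labSum [CharZero 𝕜] {K J : Type} [Finite K] [Finite J]
    [LinearOrder K] [PartialOrder J] {φ : K → J} (hφ : Monotone φ) (Z : K → A.gr 0) {N p : ℕ}
    (hN : N < p) :
    ∑ n ∈ Finset.range p, ((n.factorial : 𝕜))⁻¹ • ∑ m ∈ Finset.piAntidiag Finset.univ N,
      (∏ v : Fin n, ((m v).factorial : 𝕜)⁻¹) • ∑ q ∈ levelings (Fin n) (fun _ : J => True),
        A.opZero q.2 (fun v => A.labSum (Fin (m v)) (fun k => φ k = q.1 v) Z) =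
    ((N.factorial : 𝕜))⁻¹ • A.labSum (Fin N) (fun _ : K => True) Z := by
  classical
  have h1 : ∀ n, ∑ m ∈ Finset.piAntidiag Finset.univ N,
      (∏ v : Fin n, ((m v).factorial : 𝕜)⁻¹) • ∑ q ∈ levelings (Fin n) (fun _ : J => True),
        A.opZero q.2 (fun v => A.labSum (Fin (m v)) (fun k => φ k = q.1 v) Z) =
      ((N.factorial : 𝕜))⁻¹ • ∑ π : Fin N → Fin n, ∑ s ∈ levelings (Fin N) (fun _ : K => True),
        if IsComponents φ s π then A.opZero s.2 (fun u => Z (s.1 u)) else 0 := by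
    intro n
    rw [← inv_factorial_smul_sum_fibre_card]
    congr 1
    refine Finset.sum_congr rfl fun π _ => ?_
    rw [← Finset.sum_filter]
    have h := A.sum_opZero_labSum hφ π Z
    have hset : (Set.toFinite {s | s ∈ levelings (Fin N) (fun _ : K => True) ∧
        IsComponents φ s π}).toFinset =
        (levelings (Fin N) (fun _ : K => True)).filter (fun s => IsComponents φ s π) := by
      ext s
      simp
    rw [hset] at h
    rw [← h]
    refine Finset.sum_congr rfl fun q _ => ?_
    congr 1
    ext1 v
    exact A.labSum_congr (Finite.equivFin {u // π u = v}).symm _ Z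
  simp only [h1]
  simp only [smul_comm _ ((N.factorial : 𝕜))⁻¹]
  rw [← Finset.smul_sum]
  congr 1
  simp only [Finset.sum_comm (s := (Finset.univ : Finset (Fin N → Fin _)))]
  simp only [Finset.smul_sum (s := levelings (Fin N) (fun _ : K => True))]
  rw [Finset.sum_comm, labSum]
  refine Finset.sum_congr rfl fun s _ => ?_
  have h2 : ∀ n, ∑ π : Fin N → Fin n,
      (if IsComponents φ s π then A.opZero s.2 (fun u => Z (s.1 u)) else 0) =
      (Nat.card {π : Fin N → Fin n // Function.Surjective π ∧
        ∀ a b, π a = π b ↔ (levelGraph φ s).reachableSetoid a b} : 𝕜) •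
          A.opZero s.2 (fun u => Z (s.1 u)) := by
    intro n
    rw [← Finset.sum_filter, Finset.sum_const, Nat.cast_smul_eq_nsmul,
      Nat.card_eq_fintype_card, Fintype.card_subtype]
    congr 2
    ext π
    rw [Finset.mem_filter, Finset.mem_filter]
    rfl
  simp only [h2, smul_smul]
  rw [← Finset.sum_smul, sum_inv_factorial_mul_card_surjectiveKer _ (by simpa using hN), one_smul]

/-- After multilinear expansion, terms with fewer than `p` vertices in total match exactly by the
previous lemma; the others, present because each input is truncated separately, lie in `F_p`. -/
theorem truncSum_comp_sub_mem [CharZero 𝕜] {K J : Type} [Finite K] [Finite J]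
    [LinearOrder K] [PartialOrder J] {φ : K → J} (hφ : Monotone φ) {Z : K → A.gr 0}
    (hZ : ∀ k, Z k ∈ A.filZero 1) (p : ℕ) :
    A.truncSum (fun _ : J => True) (fun l => A.truncSum (fun k => φ k = l) Z p) p -
      A.truncSum (fun _ : K => True) Z p ∈ A.filZero p := by
  classical
  have hright : A.truncSum (fun _ : K => True) Z p = ∑ n ∈ Finset.range p, ((n.factorial : 𝕜))⁻¹ •
      ∑ N ∈ Finset.range p, ∑ m ∈ Finset.piAntidiag Finset.univ N,
      (∏ v : Fin n, ((m v).factorial : 𝕜)⁻¹) • ∑ q ∈ levelings (Fin n) (fun _ : J => True),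
        A.opZero q.2 (fun v => A.labSum (Fin (m v)) (fun k => φ k = q.1 v) Z) := by
    simp only [Finset.smul_sum (s := Finset.range p)]
    rw [Finset.sum_comm, truncSum]
    refine Finset.sum_congr rfl fun N hN => ?_
    exact (A.sum_inv_factorial_opZero_labSum hφ Z (Finset.mem_range.1 hN)).symm
  have hleft : ∀ n, A.labSum (Fin n) (fun _ : J => True)
      (fun l => A.truncSum (fun k => φ k = l) Z p) =
      ∑ m ∈ Fintype.piFinset (fun _ : Fin n => Finset.range p),
        (∏ v : Fin n, ((m v).factorial : 𝕜)⁻¹) •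
        ∑ q ∈ levelings (Fin n) (fun _ : J => True),
          A.opZero q.2 (fun v => A.labSum (Fin (m v)) (fun k => φ k = q.1 v) Z) := by
    intro n
    simp only [Finset.smul_sum]
    rw [Finset.sum_comm, labSum]
    refine Finset.sum_congr rfl fun q _ => ?_
    simp only [truncSum]
    rw [MultilinearMap.map_sum_finset]
    refine Finset.sum_congr rfl fun m _ => ?_
    exact MultilinearMap.map_smul_univ _ _ _
  rw [hright, truncSum, ← Finset.sum_sub_distrib]
  refine sum_mem fun n _ => ?_
  rw [← smul_sub]
  refine Submodule.smul_mem _ _ ?_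
  -- `m` records the sizes of the inserted graphs; split according to their total size.
  rw [hleft n, ← Finset.sum_filter_add_sum_filter_not _ (fun m => ∑ v, m v < p)]
  have hsmall : ∀ f : (Fin n → ℕ) → A.gr 0,
      ∑ m ∈ (Fintype.piFinset (fun _ : Fin n => Finset.range p)).filter (fun m => ∑ v, m v < p),
        f m = ∑ N ∈ Finset.range p, ∑ m ∈ Finset.piAntidiag Finset.univ N, f m := by
    intro f
    rw [← Finset.sum_fiberwise_of_maps_to (t := Finset.range p) (g := fun m : Fin n → ℕ => ∑ v, m v)
      (fun m hm => Finset.mem_range.2 (Finset.mem_filter.1 hm).2)]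
    refine Finset.sum_congr rfl fun N hN => Finset.sum_congr ?_ fun _ _ => rfl
    ext m
    simp only [Finset.mem_filter, Fintype.mem_piFinset, Finset.mem_range, Finset.mem_piAntidiag,
      Finset.mem_univ, implies_true, and_true]
    constructor
    · exact fun h => h.2
    · rintro rfl
      have hN' := Finset.mem_range.1 hN
      exact ⟨⟨fun v => (Finset.single_le_sum (f := m) (fun _ _ => Nat.zero_le _)
        (Finset.mem_univ v)).trans_lt hN', hN'⟩, rfl⟩
  rw [hsmall, add_sub_cancel_left]
  refine sum_mem fun m hm => Submodule.smul_mem _ _ (sum_mem fun q _ => ?_)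
  refine A.filZero_antitone (not_lt.1 (Finset.mem_filter.1 hm).2) ?_
  refine A.opZero_mem q.2 m _ fun v => ?_
  simpa using A.labSum_mem (fun k => φ k = q.1 v) Z hZ (Fin (m v))

theorem truncSum_sub_mem {K : Type} [Finite K] [LT K] (P : K → Prop) {Z W : K → A.gr 0} {p : ℕ}
    (h : ∀ k, Z k - W k ∈ A.filZero p) (q : ℕ) :
    A.truncSum P Z q - A.truncSum P W q ∈ A.filZero p := by
  rw [truncSum, truncSum, ← Finset.sum_sub_distrib]
  refine sum_mem fun n _ => ?_
  rw [← smul_sub, labSum, labSum, ← Finset.sum_sub_distrib]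
  exact Submodule.smul_mem _ _ (sum_mem fun s _ =>
    A.opZero_sub_mem_of_sub_mem s.2 p _ _ fun u => h _)

variable {A} in
/-- Composition of sums over leveled graphs: the levels `k` with `φ k = l` are merged into the
level `l`. -/
theorem IsLevSum.comp [CharZero 𝕜] {K J : Type} [Finite K] [Finite J]
    [LinearOrder K] [PartialOrder J] {φ : K → J} (hφ : Monotone φ) {Z : K → A.gr 0}
    (hZ : ∀ k, Z k ∈ A.filZero 1) {W : J → A.gr 0}
    (hW : ∀ l, A.IsLevSum (fun k => φ k = l) Z (W l)) {s : A.gr 0}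
    (hs : A.IsLevSum (fun _ : J => True) W s) : A.IsLevSum (fun _ : K => True) Z s := by
  intro p
  have h1 := hs p
  have h2 := A.truncSum_sub_mem (fun _ : J => True) (fun l => hW l p) p
  have h3 := A.truncSum_comp_sub_mem hφ hZ p
  simpa using add_mem (add_mem h1 h2) h3

end CompleteLieGraphAlg

/-! ### From labelled to unlabelled graphs -/

/-- The `k`-leveled graphs with vertices labelled by `Fin n`. -/
abbrev LabelledLevGraph (n k : ℕ) : Type :=
  {p : (Fin n → Fin k) × DSGraph (Fin n) // ∀ a b, p.2.adj a b → p.1 b < p.1 a}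

namespace LabelledLevGraph

/-- The underlying leveled graph. -/
def toLevGraph {n k : ℕ} (p : LabelledLevGraph n k) : LevGraph k := ⟨n, p.1.2, p.1.1, p.2⟩

/-- The underlying unlabelled leveled graph. -/
def toUnlabelled {n k : ℕ} (p : LabelledLevGraph n k) : UnlabelledLevGraph k :=
  Quotient.mk _ p.toLevGraph

/-- An isomorphism out of `p` is a permutation of the labels, and the permutation determines its
target by transport. -/
theorem card_iso {n k : ℕ} (p : LabelledLevGraph n k) :
    Nat.card (Σ q : {q : LabelledLevGraph n k // q.toUnlabelled = p.toUnlabelled},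
      LevGraph.Iso p.toLevGraph q.1.toLevGraph) = n.factorial := by
  let F : (Σ q : {q : LabelledLevGraph n k // q.toUnlabelled = p.toUnlabelled},
      LevGraph.Iso p.toLevGraph q.1.toLevGraph) → Equiv.Perm (Fin n) := fun q => q.2.toEquiv
  have hF : Function.Bijective F := by
    constructor
    · rintro ⟨⟨⟨⟨l, γ⟩, h⟩, hq⟩, e⟩ ⟨⟨⟨⟨l', γ'⟩, h'⟩, hq'⟩, e'⟩ hee
      change e.toEquiv = e'.toEquiv at hee
      have hee' : ∀ a : Fin n, (e.toEquiv a : Fin n) = e'.toEquiv a :=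
        fun a => congrArg (fun σ : Equiv.Perm (Fin n) => σ a) hee
      have hl : l = l' := by
        ext1 a
        obtain ⟨b, rfl⟩ := e.toEquiv.surjective a
        exact (e.level_eq b).trans ((e'.level_eq b).symm.trans (congrArg l' (hee' b).symm))
      have hγ : γ = γ' := by
        ext a b
        obtain ⟨a, rfl⟩ := e.toEquiv.surjective a
        obtain ⟨b, rfl⟩ := e.toEquiv.surjective b
        exact (e.adj_iff a b).trans ((e'.adj_iff a b).symm.trans
          (iff_of_eq (congrArg₂ γ'.adj (hee' a).symm (hee' b).symm)))
      subst hl hγ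
      congr 1
      exact LevGraph.Iso.ext hee
    · intro σ
      let q : LabelledLevGraph n k := ⟨(fun a => p.1.1 (σ.symm a), p.1.2.relabel σ),
        fun a b hab => p.2 _ _ hab⟩
      let e : LevGraph.Iso p.toLevGraph q.toLevGraph :=
        { toEquiv := σ
          adj_iff := (DSGraph.relabel_eq_iff σ p.1.2 _).1 rfl
          level_eq := fun a => congrArg p.1.1 (σ.symm_apply_apply a) }
      exact ⟨⟨⟨q, Quotient.sound ⟨e.symm⟩⟩, e⟩, rfl⟩
  rw [Nat.card_congr (Equiv.ofBijective F hF), Nat.card_perm, Nat.card_eq_fintype_card,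
    Fintype.card_fin]

/-- The number of labellings of an unlabelled leveled graph. -/
theorem card_mul_card_aut {n k : ℕ} (p : LabelledLevGraph n k) :
    Nat.card {q : LabelledLevGraph n k // q.toUnlabelled = p.toUnlabelled} *
      Nat.card p.toLevGraph.Aut = n.factorial := by
  rw [← card_iso p, ← Nat.card_prod]
  refine Nat.card_congr ((Equiv.sigmaEquivProd _ _).symm.trans (Equiv.sigmaCongrRight fun q => ?_))
  have e : LevGraph.Iso p.toLevGraph q.1.toLevGraph := (Quotient.exact q.2.symm).some
  exact
    { toFun := fun s => s.trans e
      invFun := fun s => s.trans e.symm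
      left_inv := fun s =>
        LevGraph.Iso.ext (Equiv.ext fun a => e.toEquiv.symm_apply_apply (s.toEquiv a))
      right_inv := fun s =>
        LevGraph.Iso.ext (Equiv.ext fun a => e.toEquiv.apply_symm_apply (s.toEquiv a)) }

end LabelledLevGraph

namespace CompleteLieGraphAlg

open DSGraph

variable {𝕜 : Type u} [Field 𝕜] (A : CompleteLieGraphAlg.{u, v} 𝕜)

variable {A} in
/-- The element `x` of `𝔤₀` underlying `𝟙 + x`. -/
def OnePlus.toZero (x : A.OnePlus) : A.gr 0 := ⟨x.val, x.mem_gr⟩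

variable {A} in
theorem OnePlus.toZero_mem (x : A.OnePlus) : x.toZero ∈ A.filZero 1 := x.mem_fil

variable {A} in
theorem OnePlus.toZero_injective : Function.Injective (OnePlus.toZero (A := A)) :=
  fun _ _ h => OnePlus.ext (congrArg Subtype.val h)

section HasFilteredSum

variable {k : ℕ} (z : Fin k → A.OnePlus)

theorem coe_labSum_fin (n : ℕ) [Fintype (LabelledLevGraph n k)] :
    (A.labSum (Fin n) (fun _ => True) (fun l => (z l).toZero) : A.carrier) =
      ∑ p : LabelledLevGraph n k, A.levOp z p.toLevGraph := by
  rw [labSum, AddSubmonoidClass.coe_finsetSum]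
  refine Finset.sum_bij' (fun p hp => ⟨p, (mem_levelings.1 hp).2⟩) (fun p _ => p.1)
    (fun _ _ => Finset.mem_univ _) (fun p _ => mem_levelings.2 ⟨fun _ => trivial, p.2⟩)
    (fun _ _ => rfl) (fun _ _ => rfl) (fun p _ => ?_)
  rw [coe_opZero_fin]
  rfl

-- Grouping labelled graphs by isomorphism class replaces `1/n!` by `1/n! · n!/|Aut| = 1/|Aut|`.
open Classical in
theorem inv_factorial_smul_coe_labSum [CharZero 𝕜] (n : ℕ) [Fintype (LabelledLevGraph n k)] :
    ((n.factorial : 𝕜))⁻¹ •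
      (A.labSum (Fin n) (fun _ => True) (fun l => (z l).toZero) : A.carrier) =
      ∑ c ∈ Finset.univ.image (LabelledLevGraph.toUnlabelled (n := n) (k := k)),
        A.levTerm z c := by
  let f : UnlabelledLevGraph k → A.carrier :=
    Quotient.lift (A.levOp z) fun g h ⟨e⟩ => A.levOp_congr z e
  have h1 : ∑ p : LabelledLevGraph n k, A.levOp z p.toLevGraph =
      ∑ p : LabelledLevGraph n k, f p.toUnlabelled := rfl
  rw [coe_labSum_fin, h1, Finset.sum_comp, Finset.smul_sum]
  refine Finset.sum_congr rfl fun c hc => ?_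
  obtain ⟨p, -, rfl⟩ := Finset.mem_image.1 hc
  change _ = ((Nat.card p.toLevGraph.Aut : 𝕜))⁻¹ • A.levOp z p.toLevGraph
  change _ • _ • A.levOp z p.toLevGraph = _
  rw [← Nat.cast_smul_eq_nsmul 𝕜, smul_smul]
  congr 1
  have h := p.card_mul_card_aut
  rw [Nat.card_eq_fintype_card, Fintype.card_subtype] at h
  have h0 : (n.factorial : 𝕜) ≠ 0 := Nat.cast_ne_zero.2 n.factorial_ne_zero
  rw [← h] at h0 ⊢
  push_cast at h0 ⊢
  have h2 := left_ne_zero_of_mul h0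
  have h3 := right_ne_zero_of_mul h0
  field_simp

theorem levTerm_mem {c : UnlabelledLevGraph k} {p : ℕ}
    (hc : ∀ g : LevGraph k, Quotient.mk _ g = c → p ≤ g.size) : A.levTerm z c ∈ A.fil p := by
  induction c using Quotient.inductionOn with
  | h g =>
    refine Submodule.smul_mem _ _ (A.fil_antitone (hc g rfl) ?_)
    have := A.op_mem_fil g.graph (fun _ => 1) (fun a => (z (g.level a)).val)
      (fun a => (z (g.level a)).mem_fil)
    simp only [Finset.sum_const, Finset.card_univ, Fintype.card_fin, smul_eq_mul, mul_one] at this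
    exact this

theorem hasFilteredSum_levTerm [CharZero 𝕜] {s : A.gr 0}
    (hs : A.IsLevSum (fun _ => True) (fun l => (z l).toZero) s) :
    A.HasFilteredSum (A.levTerm z) s := by
  classical
  intro p
  have _ : ∀ n, Fintype (LabelledLevGraph n k) := fun n => Fintype.ofFinite _
  -- `S` consists of the classes with fewer than `p` vertices; its partial sum is the truncation,
  -- and every other term lies in `F_p`.
  let S : Finset (UnlabelledLevGraph k) := (Finset.range p).biUnion fun n =>
    Finset.univ.image (LabelledLevGraph.toUnlabelled (n := n) (k := k))
  have hS : ∑ c ∈ S, A.levTerm z c =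
      A.truncSum (fun _ => True) (fun l => (z l).toZero) p := by
    rw [Finset.sum_biUnion, truncSum, AddSubmonoidClass.coe_finsetSum]
    · refine Finset.sum_congr rfl fun n _ => ?_
      rw [← inv_factorial_smul_coe_labSum]
      rfl
    · intro n _ m _ hnm
      refine Finset.disjoint_left.2 fun c hc hc' => hnm ?_
      obtain ⟨q, -, rfl⟩ := Finset.mem_image.1 hc
      obtain ⟨q', -, hq⟩ := Finset.mem_image.1 hc'
      obtain ⟨e⟩ := Quotient.exact hq
      exact (Fin.equiv_iff_eq.1 ⟨e.toEquiv⟩).symm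
  filter_upwards [eventually_ge_atTop S] with T hT
  rw [← Finset.sum_sdiff hT, hS, add_comm, ← sub_sub]
  refine sub_mem (hs p) (sum_mem fun c hc => A.levTerm_mem z fun g hg => ?_)
  by_contra h
  refine (Finset.mem_sdiff.1 hc).2 (Finset.mem_biUnion.2
    ⟨g.size, Finset.mem_range.2 (not_le.1 h), Finset.mem_image.2
      ⟨⟨(g.level, g.graph), g.level_lt⟩, Finset.mem_univ _, hg⟩⟩)

end HasFilteredSum

/-! ### Estimates for the series -/

section Contraction

variable {A} {K : Type} [Finite K] [LT K] {P : K → Prop}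

theorem IsLevSum.mem {Z : K → A.gr 0} {s : A.gr 0} (hs : A.IsLevSum P Z s) :
    s ∈ A.filZero 1 := by
  have := hs 1
  rwa [truncSum, Finset.sum_range_one, labSum_zero, smul_zero, sub_zero] at this

theorem IsLevSum.sub_mem {Z W : K → A.gr 0} {s t : A.gr 0} (hs : A.IsLevSum P Z s)
    (ht : A.IsLevSum P W t) {p : ℕ} (h : ∀ k, Z k - W k ∈ A.filZero p) :
    s - t ∈ A.filZero p := by
  have := _root_.sub_mem (add_mem (hs p) (A.truncSum_sub_mem P h p)) (ht p)
  simpa using this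

/-- The additional graphs have a vertex with input `0`, so their terms vanish. -/
theorem IsLevSum.of_eq_zero {Z : K → A.gr 0} {s : A.gr 0} (hs : A.IsLevSum P Z s)
    (hZ : ∀ k, ¬ P k → Z k = 0) : A.IsLevSum (fun _ => True) Z s := by
  refine hs.congr fun n => Finset.sum_subset (fun p hp => ?_) fun p hp hp' => ?_
  · exact mem_levelings.2 ⟨fun _ => trivial, (mem_levelings.1 hp).2⟩
  · rw [mem_levelings] at hp hp'
    have : ¬ ∀ u, P (p.1 u) := fun h => hp' ⟨h, hp.2⟩
    push Not at this
    obtain ⟨u, hu⟩ := this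
    exact MultilinearMap.map_coord_zero _ u (hZ _ hu)

/-- The nonlinear part of the sums over leveled graphs is contracting. -/
theorem IsLevSum.sub_sum_sub_mem {K : Type} [Fintype K] [LT K] {Z W : K → A.gr 0} {s t : A.gr 0}
    (hs : A.IsLevSum (fun _ => True) Z s) (ht : A.IsLevSum (fun _ => True) W t)
    (hZ : ∀ k, Z k ∈ A.filZero 1) (hW : ∀ k, W k ∈ A.filZero 1) {p : ℕ}
    (h : ∀ k, Z k - W k ∈ A.filZero p) :
    (s - ∑ k, Z k) - (t - ∑ k, W k) ∈ A.filZero (p + 1) := by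
  -- Size 0 contributes nothing and size 1 gives the linear part; in sizes `n + 2` a change in `F_p`
  -- is accompanied by at least one other input in `F₁`, which gains a step.
  have htrunc : ∀ Z : K → A.gr 0, A.truncSum (fun _ => True) Z (p + 2) =
      ∑ n ∈ Finset.range p, (((n + 2).factorial : 𝕜))⁻¹ •
        A.labSum (Fin (n + 2)) (fun _ => True) Z + ∑ k, Z k := by
    intro Z
    classical
    rw [truncSum, Finset.sum_range_succ', Finset.sum_range_succ', labSum_zero, labSum_one]
    simp
  have h1 := A.filZero_antitone (show p + 1 ≤ p + 2 by omega) (hs (p + 2))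
  have h2 := A.filZero_antitone (show p + 1 ≤ p + 2 by omega) (ht (p + 2))
  rw [htrunc] at h1 h2
  have h3 : ∑ n ∈ Finset.range p, (((n + 2).factorial : 𝕜))⁻¹ •
        A.labSum (Fin (n + 2)) (fun _ => True) Z - ∑ n ∈ Finset.range p,
          (((n + 2).factorial : 𝕜))⁻¹ • A.labSum (Fin (n + 2)) (fun _ => True) W ∈
      A.filZero (p + 1) := by
    rw [← Finset.sum_sub_distrib]
    refine sum_mem fun n _ => ?_
    rw [← smul_sub, labSum, labSum, ← Finset.sum_sub_distrib]
    refine Submodule.smul_mem _ _ (sum_mem fun q _ => ?_)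
    have := A.opZero_sub_mem q.2 p 1 (fun u => Z (q.1 u)) (fun u => W (q.1 u))
      (fun u => hZ _) (fun u => hW _) (fun u => h _)
    refine A.filZero_antitone ?_ this
    simp
  have := _root_.sub_mem (add_mem h1 h3) h2
  convert this using 1
  abel

end Contraction

end CompleteLieGraphAlg

/-! ### The complete group -/

namespace CompleteLieGraphAlg

open DSGraph

variable {𝕜 : Type u} [Field 𝕜] {A : CompleteLieGraphAlg.{u, v} 𝕜}

namespace OnePlus

theorem exists_prod (x y : A.OnePlus) : ∃ w : A.OnePlus,
    A.IsLevSum (fun _ => True) (fun l => (![x, y] l).toZero) w.toZero := by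
  obtain ⟨s, hs⟩ := A.exists_isLevSum (fun _ => True) (fun l => (![x, y] l).toZero)
    (fun l => toZero_mem _)
  exact ⟨⟨s, hs.mem, s.2⟩, hs⟩

/-- The product `(𝟙 + x) ⊚ (𝟙 + y)`. -/
noncomputable def prod (x y : A.OnePlus) : A.OnePlus := (exists_prod x y).choose

theorem isLevSum_prod (x y : A.OnePlus) :
    A.IsLevSum (fun _ => True) (fun l => (![x, y] l).toZero) (prod x y).toZero :=
  (exists_prod x y).choose_spec

/-- A sum over graphs with two levels, seen as a sum over graphs with more levels. -/
theorem isLevSum_of_two {k : ℕ} (z : Fin k → A.OnePlus) (P : Fin k → Prop) (i j : Fin k)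
    (hij : i < j) (hP : ∀ l, P l ↔ i = l ∨ j = l) :
    A.IsLevSum P (fun l => (z l).toZero) (prod (z i) (z j)).toZero := by
  refine (isLevSum_prod (z i) (z j)).congr fun n => ?_
  rw [A.labSum_of_embedding P (fun l => (z l).toZero) ![i, j]]
  · congr 1
    ext l
    fin_cases l <;> rfl
  · intro a b h
    fin_cases a <;> fin_cases b <;> simp [hij.ne, hij.ne'] at h ⊢
  · intro a b
    fin_cases a <;> fin_cases b <;> simp [hij, hij.le]
  · intro l
    simp [hP]

theorem unit_prod (x : A.OnePlus) : prod (unit A) x = x := by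
  refine toZero_injective ((isLevSum_prod _ _).unique
    ((A.isLevSum_of_unique (P := fun l => l = 1) (Z := fun l => (![unit A, x] l).toZero)
      (fun l => toZero_mem _) 1 fun _ => Iff.rfl).of_eq_zero fun l hl => ?_))
  fin_cases l
  · rfl
  · exact absurd rfl hl

theorem prod_sub_prod_mem {x x' y y' : A.OnePlus} {p : ℕ}
    (hx : x.toZero - x'.toZero ∈ A.filZero p) (hy : y.toZero - y'.toZero ∈ A.filZero p) :
    (prod x y).toZero - (prod x' y').toZero ∈ A.filZero p := by
  refine (isLevSum_prod x y).sub_mem (isLevSum_prod x' y') fun l => ?_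
  fin_cases l
  · exact hx
  · exact hy

/-- The iteration which converges to the inverse of `𝟙 + x`. -/
noncomputable def invSeq (x : A.OnePlus) : ℕ → A.OnePlus
  | 0 => unit A
  | n + 1 => ⟨(invSeq x n).val - (prod (invSeq x n) x).val,
      sub_mem (invSeq x n).mem_fil (prod (invSeq x n) x).mem_fil,
      sub_mem (invSeq x n).mem_gr (prod (invSeq x n) x).mem_gr⟩

theorem toZero_invSeq_succ (x : A.OnePlus) (n : ℕ) :
    (invSeq x (n + 1)).toZero = (invSeq x n).toZero - (prod (invSeq x n) x).toZero := rfl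

/-- The iterated map `y ↦ y - prod y x` equals `-x` minus the nonlinear part of the product, hence
each iteration gains one step of the filtration. -/
theorem invSeq_succ_sub_mem (x : A.OnePlus) (n : ℕ) :
    (invSeq x (n + 1)).toZero - (invSeq x n).toZero ∈ A.filZero (n + 1) := by
  induction n with
  | zero => exact sub_mem (toZero_mem _) (toZero_mem _)
  | succ n ih =>
    have h := (isLevSum_prod (invSeq x (n + 1)) x).sub_sum_sub_mem (isLevSum_prod (invSeq x n) x)
      (fun l => toZero_mem _) (fun l => toZero_mem _) (p := n + 1) (fun l => by
        fin_cases l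
        · exact ih
        · simp)
    rw [← neg_mem_iff]
    convert h using 1
    rw [toZero_invSeq_succ x (n + 1), toZero_invSeq_succ x n]
    simp only [Fin.sum_univ_two, Matrix.cons_val_zero, Matrix.cons_val_one]
    rw [toZero_invSeq_succ x n]
    abel

/-- At the limit `y` of `invSeq x`, `prod y x` is congruent modulo `F_p` to the difference of two
consecutive iterates, hence to `0`, for every `p`. -/
theorem exists_inv (x : A.OnePlus) : ∃ y : A.OnePlus, prod y x = unit A := by
  obtain ⟨s, hs⟩ := A.exists_limit (fun n => (invSeq x n).toZero) fun p q hpq => by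
    induction q, hpq using Nat.le_induction with
    | base => simp
    | succ q hpq ih =>
      rw [← sub_add_sub_cancel _ (invSeq x q).toZero]
      exact add_mem (A.filZero_antitone (hpq.trans q.le_succ) (invSeq_succ_sub_mem x q)) ih
  have hs1 : s ∈ A.filZero 1 := by simpa using add_mem (hs 1) (toZero_mem (invSeq x 1))
  let y : A.OnePlus := ⟨s, hs1, s.2⟩
  refine ⟨y, toZero_injective (A.eq_of_forall_sub_mem fun p => ?_)⟩
  have h1 : (prod y x).toZero - (prod (invSeq x p) x).toZero ∈ A.filZero p :=
    prod_sub_prod_mem (hs p) (by simp)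
  have h2 := A.filZero_antitone p.le_succ (invSeq_succ_sub_mem x p)
  rw [toZero_invSeq_succ, sub_sub_cancel_left] at h2
  have h3 := sub_mem h1 h2
  rw [sub_neg_eq_add, sub_add_cancel] at h3
  exact sub_mem h3 (zero_mem (A.filZero p))

variable [CharZero 𝕜]

/-- The product bracketed to the left is the sum over 3-leveled graphs. -/
theorem isLevSum_prod_prod (x y z : A.OnePlus) :
    A.IsLevSum (fun _ => True) (fun l => (![x, y, z] l).toZero) (prod (prod x y) z).toZero := by
  -- Merging the two bottom levels gives this bracketing; merging the two top ones, with `![0, 1,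
  -- 1]`, gives the other.
  refine IsLevSum.comp (φ := ![0, 0, 1]) (J := Fin 2) (by decide) (fun l => toZero_mem _)
    (fun l => ?_) (isLevSum_prod (prod x y) z)
  fin_cases l
  · exact isLevSum_of_two ![x, y, z] _ 0 1 (by decide) (by decide)
  · exact A.isLevSum_of_unique (Z := fun l => (![x, y, z] l).toZero) (fun l => toZero_mem _) 2
      (by decide)

/-- The product bracketed to the right is the sum over 3-leveled graphs. -/
theorem isLevSum_prod_prod' (x y z : A.OnePlus) :
    A.IsLevSum (fun _ => True) (fun l => (![x, y, z] l).toZero) (prod x (prod y z)).toZero := by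
  refine IsLevSum.comp (φ := ![0, 1, 1]) (J := Fin 2) (by decide) (fun l => toZero_mem _)
    (fun l => ?_) (isLevSum_prod x (prod y z))
  fin_cases l
  · exact A.isLevSum_of_unique (Z := fun l => (![x, y, z] l).toZero) (fun l => toZero_mem _) 0
      (by decide)
  · exact isLevSum_of_two ![x, y, z] _ 1 2 (by decide) (by decide)

variable (A) in
/-- The group structure on `𝟙 + F₁𝔤₀`. -/
noncomputable abbrev group : Group A.OnePlus :=
  letI : Mul A.OnePlus := ⟨prod⟩
  letI : One A.OnePlus := ⟨unit A⟩
  letI : Inv A.OnePlus := ⟨fun x => (exists_inv x).choose⟩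
  Group.ofLeftAxioms
    (fun x y z => toZero_injective ((isLevSum_prod_prod x y z).unique (isLevSum_prod_prod' x y z)))
    unit_prod (fun x => (exists_inv x).choose_spec)

section Filtration

attribute [local instance] group

theorem one_toZero : (1 : A.OnePlus).toZero = 0 := rfl

theorem mul_sub_mul_mem {x x' y y' : A.OnePlus} {p : ℕ}
    (hx : x.toZero - x'.toZero ∈ A.filZero p) (hy : y.toZero - y'.toZero ∈ A.filZero p) :
    (x * y).toZero - (x' * y').toZero ∈ A.filZero p :=
  prod_sub_prod_mem hx hy

/-- Left translations preserve congruence modulo `F_p`; so cosets in the group are the additive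
congruence classes, and completeness can be transferred. -/
theorem inv_mul_mem_iff {x y : A.OnePlus} {p : ℕ} :
    (x⁻¹ * y).toZero ∈ A.filZero p ↔ y.toZero - x.toZero ∈ A.filZero p := by
  constructor
  · intro h
    have := mul_sub_mul_mem (x := x) (x' := x) (y := x⁻¹ * y) (y' := 1) (p := p) (by simp)
      (by simpa [one_toZero] using h)
    simpa using this
  · intro h
    have := mul_sub_mul_mem (x := x⁻¹) (x' := x⁻¹) (y := y) (y' := x) (p := p) (by simp) h
    simpa [one_toZero] using this

variable (A) in
/-- The subgroup `𝟙 + F_p𝔤₀`. -/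
noncomputable def filSubgroup (p : ℕ+) : Subgroup A.OnePlus where
  carrier := {x | x.toZero ∈ A.filZero p}
  one_mem' := zero_mem (A.filZero p)
  mul_mem' {x y} hx hy := by
    have := mul_sub_mul_mem (x := x) (x' := 1) (y := y) (y' := 1) (p := p)
      (by simpa [one_toZero] using hx) (by simpa [one_toZero] using hy)
    simpa [one_toZero] using this
  inv_mem' {x} hx := by
    have := (inv_mul_mem_iff (x := x) (y := 1) (p := p)).2 (by
      rw [one_toZero, zero_sub, neg_mem_iff]
      exact hx)
    simpa using this

theorem mem_filSubgroup {p : ℕ+} {x : A.OnePlus} :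
    x ∈ filSubgroup A p ↔ x.toZero ∈ A.filZero p := Iff.rfl

theorem filSubgroup_antitone : Antitone (filSubgroup A) :=
  fun _ _ hpq _ hx => A.filZero_antitone hpq hx

theorem mk_eq_mk_iff {p : ℕ+} {x y : A.OnePlus} :
    (QuotientGroup.mk x : A.OnePlus ⧸ filSubgroup A p) = QuotientGroup.mk y ↔
      y.toZero - x.toZero ∈ A.filZero p := by
  rw [QuotientGroup.eq, mem_filSubgroup, inv_mul_mem_iff]

variable (A) in
/-- The complete group `𝟙 + F₁𝔤₀`. -/
noncomputable def completeGroupStr : CompleteGroupStr A.OnePlus where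
  toGroup := group A
  fil := filSubgroup A
  fil_one := by
    ext x
    exact iff_of_true (toZero_mem x) trivial
  fil_antitone := filSubgroup_antitone
  -- From `x ≡ 1` follow `g * x ≡ g` and then `g * x * g⁻¹ ≡ 1` modulo `F_p`.
  normal p := ⟨fun x hx g => by
    have h := mul_sub_mul_mem (x := g * x) (x' := g) (y := g⁻¹) (y' := g⁻¹) (p := p)
      (by
        have := mul_sub_mul_mem (x := g) (x' := g) (y := x) (y' := 1) (p := p) (by simp)
          (by rw [one_toZero, sub_zero]; exact hx)
        simpa using this) (by simp)
    rw [mul_inv_cancel, one_toZero, sub_zero] at h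
    exact h⟩
  complete f hf := by
    choose g hg using fun p => QuotientGroup.mk_surjective (f p)
    have hg' : ∀ p q : ℕ+, p ≤ q → (g q).toZero - (g p).toZero ∈ A.filZero p := by
      intro p q hpq
      have h := hf p q hpq
      rw [← hg p, ← hg q] at h
      exact mk_eq_mk_iff.1 h.symm
    -- The group filtration starts at 1 and that of `𝔤₀` at 0, hence the shift by one.
    obtain ⟨s, hs⟩ := A.exists_limit (fun n => (g n.succPNat).toZero) fun p q hpq =>
      A.filZero_antitone p.le_succ (hg' _ _ (Nat.succPNat_le_succPNat.2 hpq))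
    have hs' : ∀ p : ℕ+, s - (g p).toZero ∈ A.filZero p := by
      intro p
      have h := add_mem (hs p) (hg' p (Nat.succPNat p)
        ((PNat.coe_le_coe _ _).1 (Nat.le_succ _)))
      simpa using h
    have hs1 : s ∈ A.filZero 1 := by
      have := add_mem (hs' 1) (toZero_mem (g 1))
      simpa using this
    refine ⟨⟨s, hs1, s.2⟩, fun p => ?_, fun y hy => ?_⟩
    · rw [← hg p, mk_eq_mk_iff, ← neg_mem_iff, neg_sub]
      exact hs' p
    · refine toZero_injective (A.eq_of_forall_sub_mem fun p => ?_)
      have h := hy p.succPNat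
      rw [← hg, mk_eq_mk_iff] at h
      have h' := add_mem (hs' p.succPNat) h
      rw [sub_add_sub_cancel, ← neg_mem_iff, neg_sub] at h'
      exact A.filZero_antitone p.le_succ h'

end Filtration

end OnePlus

/-! ### Functoriality -/

namespace Hom

variable {B : CompleteLieGraphAlg.{u, v} 𝕜} (f : A ⟶ B)

/-- The component of degree `0` of a morphism. -/
def zeroPart : A.gr 0 →ₗ[𝕜] B.gr 0 := (Hom.toLinearMap f).restrict (Hom.map_gr f 0)

theorem zeroPart_opZero {V : Type} [Finite V] (g : DSGraph V) (x : V → A.gr 0) :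
    zeroPart f (A.opZero g x) = B.opZero g (fun a => zeroPart f (x a)) := by
  apply Subtype.ext
  rw [coe_opZero]
  exact Hom.map_op f _ _

/-- A morphism commutes with every truncation and preserves the filtration, so it passes to the
limit; multiplicativity then follows from uniqueness of sums. -/
theorem isLevSum_zeroPart {K : Type} [Finite K] [LT K] {P : K → Prop} {Z : K → A.gr 0}
    {s : A.gr 0} (hs : A.IsLevSum P Z s) :
    B.IsLevSum P (fun k => zeroPart f (Z k)) (zeroPart f s) := by
  intro p
  have h : zeroPart f (s - A.truncSum P Z p) ∈ B.filZero p := Hom.map_fil f p _ (hs p)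
  rw [map_sub] at h
  convert h using 2
  simp only [truncSum, labSum, map_sum, map_smul, zeroPart_opZero]

theorem map_prod (x y : A.OnePlus) :
    OnePlus.map f (x.prod y) = (OnePlus.map f x).prod (OnePlus.map f y) := by
  refine OnePlus.toZero_injective ((isLevSum_zeroPart f (x.isLevSum_prod y)).unique ?_)
  convert (OnePlus.map f x).isLevSum_prod (OnePlus.map f y) using 2 with l
  fin_cases l <;> rfl

end Hom

/-- The functor from complete Lie-graph algebras to complete groups. -/
noncomputable def completeGrpFunctor (𝕜 : Type u) [Field 𝕜] [CharZero 𝕜] :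
    CompleteLieGraphAlg.{u, v} 𝕜 ⥤ CompleteGrp.{v} where
  obj A := ⟨A.OnePlus, OnePlus.completeGroupStr A⟩
  map f :=
    { toFun := OnePlus.map f
      map_mul := Hom.map_prod f
      map_fil := fun p _ hx => Hom.map_fil f p _ hx }

end CompleteLieGraphAlg

theorem mainTheorem3 (𝕜 : Type u) [Field 𝕜] [CharZero 𝕜] :
    ∃ S : ∀ A : CompleteLieGraphAlg.{u, v} 𝕜, CompleteGroupStr A.OnePlus,
      -- the product, the unit and the filtration of the group `𝟙 + F₁𝔤₀`
      (∀ (A : CompleteLieGraphAlg.{u, v} 𝕜) (x y : A.OnePlus),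
        A.HasFilteredSum (A.levTerm ![x, y]) ((S A).mul x y).val) ∧
      (∀ A : CompleteLieGraphAlg.{u, v} 𝕜, (S A).one = CompleteLieGraphAlg.OnePlus.unit A) ∧
      (∀ (A : CompleteLieGraphAlg.{u, v} 𝕜) (p : ℕ+) (x : A.OnePlus),
        x ∈ (S A).fil p ↔ x.val ∈ A.fil p) ∧
      -- both ways of bracketing a triple product give the sum over the 3-leveled graphs
      (∀ (A : CompleteLieGraphAlg.{u, v} 𝕜) (x y z : A.OnePlus),
        A.HasFilteredSum (A.levTerm ![x, y, z]) ((S A).mul ((S A).mul x y) z).val ∧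
        A.HasFilteredSum (A.levTerm ![x, y, z]) ((S A).mul x ((S A).mul y z)).val) ∧
      -- functoriality
      ∃ (Φ : CompleteLieGraphAlg.{u, v} 𝕜 ⥤ CompleteGrp.{v})
        (hΦ : ∀ A : CompleteLieGraphAlg.{u, v} 𝕜, Φ.obj A = ⟨A.OnePlus, S A⟩),
        ∀ (A B : CompleteLieGraphAlg.{u, v} 𝕜) (f : A ⟶ B) (x : A.OnePlus),
          CompleteGrp.Hom.toFun (eqToHom (hΦ A).symm ≫ Φ.map f ≫ eqToHom (hΦ B)) x =
            CompleteLieGraphAlg.OnePlus.map f x := by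
  have hΦ : ∀ A, (CompleteLieGraphAlg.completeGrpFunctor 𝕜).obj A =
      ⟨A.OnePlus, CompleteLieGraphAlg.OnePlus.completeGroupStr A⟩ := fun _ => rfl
  refine ⟨fun A => CompleteLieGraphAlg.OnePlus.completeGroupStr A, ?_⟩
  refine ⟨fun A x y => ?_, fun A => rfl,
    fun A p x => Iff.rfl, fun A x y z => ⟨?_, ?_⟩,
    CompleteLieGraphAlg.completeGrpFunctor 𝕜, hΦ, fun A B f x => ?_⟩
  · exact A.hasFilteredSum_levTerm ![x, y] (x.isLevSum_prod y)
  · exact A.hasFilteredSum_levTerm ![x, y, z] (x.isLevSum_prod_prod y z)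
  · exact A.hasFilteredSum_levTerm ![x, y, z] (x.isLevSum_prod_prod' y z)
  · rfl
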